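/- Let $\mathbb K$ be a field of characteristic $0$, $\Gamma=(\mathbb Z/2)^n$ with $\langle x,y\rangle=\sum_i x_iy_i\in\mathbb Z/2$. A degree $\gamma$ is called even (odd) if $\langle\gamma,\gamma\rangle$ is $0$ (is $1$). The standard order of $\Gamma$ puts the even degrees first and then the odd ones, each part in lexicographic order. A $\Gamma$-commutative algebra is an associative unital $\Gamma$-graded $\mathbb K$-algebra $A$ with $ab=(-1)^{\langle\alpha,\beta\rangle}ba$ for $a\in A^\alpha$, $b\in A^\beta$. Fix an odd degree $\pi$ and degrees $\gamma_1,\dots,\gamma_r\in\Gamma$, non-decreasing in the standard order (the degrees of a standard basis $e_1,\dots,e_r$ of a free graded module $M$). Let $\mathsf{GL}^0(A)$ be the group of invertible $r\times r$ matrices $T=(t^i{}_j)$ of degree $0$, i.e. with $t^i{}_j\in A^{\gamma_i+\gamma_j}$; write $X_{uv}$ for the block of $X$ with rows of degree $u$ and columns of degree $v$. **Graded Berezinian.** There is a unique family of group homomorphisms $\Gamma\mathrm{Ber}_A:\mathsf{GL}^0(A)\to(A^0)^\times$, one for each $\Gamma$-commutative $\mathbb K$-algebra $A$, compatible with degree-preserving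 algebra homomorphisms $A\to B$, such that (1) $\Gamma\mathrm{Ber}_A(X)=\prod_{u\text{ even}}\det(X_{uu})\prod_{u\text{ odd}}\det(X_{uu})^{-1}$ for block-diagonal $X$, and (2) $\Gamma\mathrm{Ber}_A(X)=1$ for every upper or lower block-unitriangular $X$ (with respect to the standard order). **Complex.** Let $\mathcal K=S_A(\Pi M\oplus M^*)$ be the graded-commutative algebra of polynomials over $A$ in variables $\Pi e_i$ of degree $\gamma_i+\pi$ and $\varepsilon^i$ of degree $\gamma_i$ (generated by $A$ and these variables, with graded commutation as the only further relations), and let $d$ be left multiplication by $\sum_i\Pi e_i\,\varepsilon^i$. Put $x_i=\varepsilon^i$, $\xi_i=\Pi e_i$ if $\gamma_i$ is even, and $x_i=\Pi e_i$, $\xi_i=-(-1)^{\langle\gamma_i,\pi\rangle}\varepsilon^i$ if $\gamma_i$ is odd. Let $\mathcal K^k$ be the set of polynomials of total degree $k$ in the $\xi$'s, and $H^k(\mathcal K^\bullet)=\ker(d|_{\mathcal K^k})/d(\mathcal K^{k-1})$ (with $\mathcal K^{-1}=0$). **Action.** A matrix $T\in\mathsf{GL}^0(A)$ acts on $\mathcal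 K$ by the $A$-algebra automorphism $\varphi_T$ with $$\varphi_T(\Pi e_i)=\sum_j\Pi e_j\,t^j{}_i,\qquad \varphi_T(\varepsilon^i)=\sum_k\varepsilon^k\,(-1)^{\langle\gamma_k+\gamma_i,\gamma_k\rangle}(T^{-1})^i{}_k ,$$ i.e. through $T$ on $\Pi M$ and through the graded transpose of $T^{-1}$ on $M^*$. It commutes with $d$ and therefore induces a right $A$-linear automorphism $\Phi(T)$ of $\ker d/\operatorname{im}d$. **Proposition.** For every $A$, the canonical map $H^r(\mathcal K^\bullet)\to\ker d/\operatorname{im}d$ is bijective, and $H^r(\mathcal K^\bullet)$ is a free right $A$-module of rank one with basis the class $[\xi_1\cdots\xi_r]$. Under this identification, for every $T\in\mathsf{GL}^0(A)$ the automorphism $\Phi(T)$ of $H^r(\mathcal K^\bullet)$ is right multiplication by $\Gamma\mathrm{Ber}_A(T)$: $$\Phi(T)(c)=c\cdot\Gamma\mathrm{Ber}_A(T)\qquad\text{for all }c\in H^r(\mathcal K^\bullet).$$ -/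

import Mathlib

universe u v

namespace GradedKoszul

open scoped RightActions

/-- The grading group `(ℤ/2)ⁿ`. -/
abbrev Deg (n : ℕ) : Type := Fin n → ZMod 2

/-- The standard scalar product `⟨x, y⟩ = ∑ xᵢ yᵢ` with values in `ℤ/2`. -/
def form {n : ℕ} (x y : Deg n) : ZMod 2 := ∑ i, x i * y i

/-- Even degrees: `⟨γ, γ⟩ = 0`. -/
abbrev IsEven {n : ℕ} (γ : Deg n) : Prop := form γ γ = 0

/-- Odd degrees: `⟨γ, γ⟩ = 1`. -/
abbrev IsOdd {n : ℕ} (γ : Deg n) : Prop := form γ γ = 1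

/-- The sign `(-1)^z` for `z ∈ ℤ/2`. -/
def sgn (z : ZMod 2) : ℤ := if z = 0 then 1 else -1

/-- The key of the standard order of `(ℤ/2)ⁿ`: even degrees come before odd ones, and inside
each of the two parts the order is lexicographic. -/
def stdKey {n : ℕ} (γ : Deg n) : ℕ ×ₗ Lex (Fin n → ℕ) :=
  toLex ((form γ γ).val, toLex fun i => (γ i).val)

lemma form_comm {n : ℕ} (x y : Deg n) : form x y = form y x := by
  simp [form, mul_comm]

lemma form_add_left {n : ℕ} (x y z : Deg n) : form (x + y) z = form x z + form y z := by
  simp [form, add_mul, Finset.sum_add_distrib]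

lemma form_add_right {n : ℕ} (x y z : Deg n) : form x (y + z) = form x y + form x z := by
  simp [form, mul_add, Finset.sum_add_distrib]

lemma sgn_add (a b : ZMod 2) : sgn (a + b) = sgn a * sgn b := by
  revert a b; decide

lemma sgn_mul_self (a : ZMod 2) : sgn a * sgn a = 1 := by
  revert a; decide

lemma sgn_zero : sgn 0 = 1 := rfl

lemma zmod2_add_self (a : ZMod 2) : a + a = 0 := by
  revert a; decide

lemma deg_add_self {n : ℕ} (γ : Deg n) : γ + γ = 0 := by
  funext i; exact zmod2_add_self _

/-- A `(ℤ/2)ⁿ`-commutative algebra over `K`: an associative unital `(ℤ/2)ⁿ`-graded algebra with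
`a b = (-1)^⟨α, β⟩ b a` for `a`, `b` homogeneous of degrees `α`, `β`. -/
structure GradedCommAlg (K : Type v) [Field K] (n : ℕ) where
  carrier : Type u
  [ring : Ring carrier]
  [algebra : Algebra K carrier]
  grading : Deg n → Submodule K carrier
  [graded : GradedAlgebra grading]
  comm : ∀ (α β : Deg n) (a b : carrier), a ∈ grading α → b ∈ grading β →
    a * b = sgn (form α β) • (b * a)

attribute [instance] GradedCommAlg.ring GradedCommAlg.algebra GradedCommAlg.graded

variable {K : Type v} [Field K] {n : ℕ}

instance : CoeSort (GradedCommAlg.{u} K n) (Type u) := ⟨GradedCommAlg.carrier⟩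

/-- The degree-zero part `A⁰` is a commutative ring. -/
instance (A : GradedCommAlg.{u} K n) : CommRing (A.grading 0) :=
  { (inferInstance : Ring (A.grading 0)) with
    mul_comm := fun a b => by
      apply Subtype.ext
      have h := A.comm 0 0 a b a.2 b.2
      simpa [form, sgn] using h }

section Matrices

variable {σ : Type} [Fintype σ] [DecidableEq σ]

/-- The ring `M⁰` of graded matrices of degree `0` for a basis with degrees `δ`: the entry in
position `(i, j)` is homogeneous of degree `δ i + δ j`. -/
def degZeroMatrices (A : GradedCommAlg.{u} K n) (δ : σ → Deg n) : Subring (Matrix σ σ A) where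
  carrier := {X | ∀ i j, X i j ∈ A.grading (δ i + δ j)}
  zero_mem' := fun _ _ => Submodule.zero_mem _
  one_mem' := fun i j => by
    by_cases h : i = j
    · subst h
      rw [Matrix.one_apply_eq, deg_add_self]
      exact SetLike.GradedOne.one_mem
    · rw [Matrix.one_apply_ne h]
      exact Submodule.zero_mem _
  add_mem' := fun hX hY i j => Submodule.add_mem _ (hX i j) (hY i j)
  neg_mem' := fun hX i j => Submodule.neg_mem _ (hX i j)
  mul_mem' := fun {X Y} hX hY i j => by
    rw [Matrix.mul_apply]
    refine Submodule.sum_mem _ fun k _ => ?_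
    have h := SetLike.GradedMul.mul_mem (hX i k) (hY k j)
    have e : δ i + δ k + (δ k + δ j) = δ i + δ j := by
      rw [add_assoc, ← add_assoc (δ k), deg_add_self, zero_add]
    rwa [e] at h

/-- The group `GL⁰` of invertible graded matrices of degree `0`. -/
abbrev GLZero (A : GradedCommAlg.{u} K n) (δ : σ → Deg n) : Type u := (degZeroMatrices A δ)ˣ

/-- The diagonal block `X_uu` of a matrix of degree `0`; its entries lie in `A⁰`. -/
def diagBlock {A : GradedCommAlg.{u} K n} {δ : σ → Deg n} (X : degZeroMatrices A δ) (u : Deg n) :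
    Matrix {i // δ i = u} {i // δ i = u} (A.grading 0) :=
  fun i j => ⟨X.1 i j, by
    have h := X.2 i j
    rwa [i.2, j.2, deg_add_self] at h⟩

/-- `X_uv = 0` for `u ≠ v`. -/
def IsBlockDiagonal {A : GradedCommAlg.{u} K n} {δ : σ → Deg n} (X : degZeroMatrices A δ) : Prop :=
  ∀ i j, δ i ≠ δ j → X.1 i j = 0

/-- `X_uu = 1` for all `u`, and `X_uv = 0` when `v` precedes `u` in the standard order. -/
def IsUpperUnitriangular {A : GradedCommAlg.{u} K n} {δ : σ → Deg n}
    (X : degZeroMatrices A δ) : Prop :=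
  (∀ u, diagBlock X u = 1) ∧ ∀ i j, stdKey (δ j) < stdKey (δ i) → X.1 i j = 0

/-- `X_uu = 1` for all `u`, and `X_uv = 0` when `u` precedes `v` in the standard order. -/
def IsLowerUnitriangular {A : GradedCommAlg.{u} K n} {δ : σ → Deg n}
    (X : degZeroMatrices A δ) : Prop :=
  (∀ u, diagBlock X u = 1) ∧ ∀ i j, stdKey (δ i) < stdKey (δ j) → X.1 i j = 0

/-- The characterization of the graded Berezinian: `G` gives, for every graded-commutative algebra
`A`, a group homomorphism `GL⁰(A) → (A⁰)ˣ`, compatible with degree-preserving algebra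
homomorphisms `A → B`, with the prescribed values on block-diagonal matrices and with the value
`1` on block-unitriangular matrices. -/
structure IsGradedBerezinian (δ : σ → Deg n)
    (G : (A : GradedCommAlg.{u} K n) → GLZero A δ →* (A.grading 0)ˣ) : Prop where
  natural : ∀ (A B : GradedCommAlg.{u} K n) (f : A →ₐ[K] B),
    (∀ (γ : Deg n) (a : A), a ∈ A.grading γ → f a ∈ B.grading γ) →
    ∀ (T : GLZero A δ) (T' : GLZero B δ), (∀ i j, T'.val.1 i j = f (T.val.1 i j)) →
      (((G B T').val : B.grading 0) : B) = f ((G A T).val : A.grading 0)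
  block_diagonal : ∀ (A : GradedCommAlg.{u} K n) (X : GLZero A δ), IsBlockDiagonal X.val →
    ((G A X).val : A.grading 0) =
      (∏ u : Deg n with IsEven u, (diagBlock X.val u).det) *
        ∏ u : Deg n with IsOdd u, Ring.inverse (diagBlock X.val u).det
  upper_unitriangular : ∀ (A : GradedCommAlg.{u} K n) (X : GLZero A δ),
    IsUpperUnitriangular X.val → G A X = 1
  lower_unitriangular : ∀ (A : GradedCommAlg.{u} K n) (X : GLZero A δ),
    IsLowerUnitriangular X.val → G A X = 1

/-- The graded transpose of a matrix of degree `0`: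
`(ᴳᵗX)_vu = (-1)^⟨u + v, v⟩ ᵗ(X_uv)` for the block in row `v` and column `u`. -/
def gradedTranspose {A : GradedCommAlg.{u} K n} {δ : σ → Deg n} (X : degZeroMatrices A δ) :
    degZeroMatrices A δ :=
  ⟨fun i j => sgn (form (δ j + δ i) (δ i)) • X.1 j i, fun i j => by
    have h := X.2 j i
    rw [add_comm] at h
    exact zsmul_mem h _⟩

end Matrices

section Polynomials

variable {σ : Type}

/-- The relations between constants `a ∈ A` and variables `s ∈ σ` that define the
graded-commutative polynomial algebra. -/
inductive PolyRel (A : GradedCommAlg.{u} K n) (δ : σ → Deg n) :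
    FreeAlgebra K (A ⊕ σ) → FreeAlgebra K (A ⊕ σ) → Prop
  | const_add (a b : A) : PolyRel A δ (FreeAlgebra.ι K (Sum.inl (a + b)))
      (FreeAlgebra.ι K (Sum.inl a) + FreeAlgebra.ι K (Sum.inl b))
  | const_mul (a b : A) : PolyRel A δ (FreeAlgebra.ι K (Sum.inl (a * b)))
      (FreeAlgebra.ι K (Sum.inl a) * FreeAlgebra.ι K (Sum.inl b))
  | const_scalar (c : K) : PolyRel A δ (FreeAlgebra.ι K (Sum.inl (algebraMap K A c)))
      (algebraMap K _ c)
  | var_const (s : σ) (α : Deg n) (a : A) (ha : a ∈ A.grading α) :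
      PolyRel A δ (FreeAlgebra.ι K (Sum.inr s) * FreeAlgebra.ι K (Sum.inl a))
        (sgn (form (δ s) α) • (FreeAlgebra.ι K (Sum.inl a) * FreeAlgebra.ι K (Sum.inr s)))
  | var_var (s t : σ) :
      PolyRel A δ (FreeAlgebra.ι K (Sum.inr s) * FreeAlgebra.ι K (Sum.inr t))
        (sgn (form (δ s) (δ t)) •
          (FreeAlgebra.ι K (Sum.inr t) * FreeAlgebra.ι K (Sum.inr s)))

/-- The graded-commutative algebra of polynomials with coefficients in `A` in graded variables
`s ∈ σ` of degrees `δ s`, i.e. the graded symmetric algebra over `A` of the free graded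
`A`-module with basis `σ`. -/
def GradedPoly (A : GradedCommAlg.{u} K n) (δ : σ → Deg n) : Type (max u v) :=
  RingQuot (PolyRel A δ)

variable (A : GradedCommAlg.{u} K n) (δ : σ → Deg n)

instance : Ring (GradedPoly A δ) := inferInstanceAs (Ring (RingQuot (PolyRel A δ)))

instance : Algebra K (GradedPoly A δ) := inferInstanceAs (Algebra K (RingQuot (PolyRel A δ)))

/-- The variables. -/
def var (s : σ) : GradedPoly A δ :=
  RingQuot.mkAlgHom K (PolyRel A δ) (FreeAlgebra.ι K (Sum.inr s))

/-- The constants. -/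
def const : A →ₐ[K] GradedPoly A δ :=
  AlgHom.ofLinearMap
    { toFun := fun a => RingQuot.mkAlgHom K (PolyRel A δ) (FreeAlgebra.ι K (Sum.inl a))
      map_add' := fun a b => by
        rw [RingQuot.mkAlgHom_rel K (PolyRel.const_add a b), map_add]
        rfl
      map_smul' := fun c a => by
        rw [Algebra.smul_def, RingQuot.mkAlgHom_rel K (PolyRel.const_mul _ a), map_mul,
          RingQuot.mkAlgHom_rel K (PolyRel.const_scalar c), AlgHom.commutes,
          RingHom.id_apply]
        exact (Algebra.smul_def (A := RingQuot (PolyRel A δ)) c _).symm }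
    (by
      have h := RingQuot.mkAlgHom_rel K (PolyRel.const_scalar (A := A) (δ := δ) 1)
      rw [map_one, map_one, map_one] at h
      exact h)
    (fun a b => by
      have h := RingQuot.mkAlgHom_rel K (PolyRel.const_mul (δ := δ) a b)
      rw [map_mul] at h
      exact h)

/-- The right `A`-module structure of the polynomial algebra. -/
instance : Module Aᵐᵒᵖ (GradedPoly A δ) :=
  Module.compHom (GradedPoly A δ) (RingHom.op (const A δ).toRingHom)

variable {A δ}

lemma smul_eq (a : A) (p : GradedPoly A δ) : p <• a = p * const A δ a := rfl

lemma var_mul_const (s : σ) (α : Deg n) (a : A) (ha : a ∈ A.grading α) :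
    var A δ s * const A δ a = sgn (form (δ s) α) • (const A δ a * var A δ s) := by
  have h := RingQuot.mkAlgHom_rel K (PolyRel.var_const (δ := δ) s α a ha)
  rw [map_mul, map_zsmul, map_mul] at h
  exact h

lemma var_mul_var (s t : σ) :
    var A δ s * var A δ t = sgn (form (δ s) (δ t)) • (var A δ t * var A δ s) := by
  have h := RingQuot.mkAlgHom_rel K (PolyRel.var_var (A := A) (δ := δ) s t)
  rw [map_mul, map_zsmul, map_mul] at h
  exact h

/-- Two elements commute like homogeneous elements of degrees `α` and `β`. -/
def GComm (α β : Deg n) (p q : GradedPoly A δ) : Prop := p * q = sgn (form α β) • (q * p)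

lemma GComm.symm {α β : Deg n} {p q : GradedPoly A δ} (h : GComm α β p q) : GComm β α q p := by
  unfold GComm at *
  rw [h, smul_smul, form_comm β α, sgn_mul_self, one_smul]

lemma GComm.mul {α α' β : Deg n} {p p' q : GradedPoly A δ} (h : GComm α β p q)
    (h' : GComm α' β p' q) : GComm (α + α') β (p * p') q := by
  unfold GComm at *
  rw [mul_assoc, h', mul_smul_comm, ← mul_assoc, h, smul_mul_assoc, smul_smul, mul_assoc,
    form_add_left, sgn_add, mul_comm]

lemma GComm.sum {ι : Type*} {s : Finset ι} {α β : Deg n} {p : ι → GradedPoly A δ}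
    {q : GradedPoly A δ} (h : ∀ i ∈ s, GComm α β (p i) q) : GComm α β (∑ i ∈ s, p i) q := by
  unfold GComm at *
  rw [Finset.sum_mul, Finset.mul_sum, Finset.smul_sum]
  exact Finset.sum_congr rfl h

lemma algHom_ext {B : Type*} [Semiring B] [Algebra K B] {f g : GradedPoly A δ →ₐ[K] B}
    (hc : ∀ a, f (const A δ a) = g (const A δ a)) (hv : ∀ s, f (var A δ s) = g (var A δ s)) :
    f = g := by
  apply RingQuot.ringQuot_ext' K
  apply FreeAlgebra.hom_ext
  funext x
  rcases x with a | s
  · exact hc a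
  · exact hv s

variable [Fintype σ] [DecidableEq σ]

lemma gcomm_const (X : degZeroMatrices A δ) (t : σ) (α : Deg n) (a : A)
    (ha : a ∈ A.grading α) :
    GComm (δ t) α (∑ s, var A δ s * const A δ (X.1 s t)) (const A δ a) := by
  refine GComm.sum fun s _ => ?_
  have h1 : GComm (δ s) α (var A δ s) (const A δ a) := var_mul_const s α a ha
  have h2 : GComm (δ s + δ t) α (const A δ (X.1 s t)) (const A δ a) := by
    unfold GComm
    rw [← map_mul, A.comm _ _ _ _ (X.2 s t) ha, map_zsmul, map_mul]
  have h := h1.mul h2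
  rwa [← add_assoc, deg_add_self, zero_add] at h

lemma gcomm_lin (X : degZeroMatrices A δ) (t t' : σ) :
    GComm (δ t) (δ t') (∑ s, var A δ s * const A δ (X.1 s t))
      (∑ s, var A δ s * const A δ (X.1 s t')) := by
  refine GComm.symm (GComm.sum fun s _ => ?_)
  have h1 : GComm (δ s) (δ t) (var A δ s) (∑ s, var A δ s * const A δ (X.1 s t)) := by
    refine GComm.symm (GComm.sum fun s' _ => ?_)
    have h1 : GComm (δ s') (δ s) (var A δ s') (var A δ s) := var_mul_var s' s
    have h2 : GComm (δ s' + δ t) (δ s) (const A δ (X.1 s' t)) (var A δ s) :=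
      GComm.symm (var_mul_const s _ _ (X.2 s' t))
    have h := h1.mul h2
    rwa [← add_assoc, deg_add_self, zero_add] at h
  have h2 := (gcomm_const X t _ _ (X.2 s t')).symm
  have h := h1.mul h2
  rwa [← add_assoc, deg_add_self, zero_add] at h

/-- The `A`-algebra endomorphism given by a matrix `X` of degree `0` acting on the column of
variables: `t ↦ ∑ₛ s · X_st` on the variables, and the identity on the constants. -/
def substHom (X : degZeroMatrices A δ) : GradedPoly A δ →ₐ[K] GradedPoly A δ :=
  RingQuot.liftAlgHom K (s := PolyRel A δ)
    ⟨FreeAlgebra.lift K (Sum.elim (fun a => const A δ a)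
      fun t => ∑ s, var A δ s * const A δ (X.1 s t)), by
    intro p q h
    induction h with
    | const_add a b => simp
    | const_mul a b => simp
    | const_scalar c => simp [AlgHom.commutes]
    | var_const s α a ha =>
      simp only [map_mul, map_zsmul, FreeAlgebra.lift_ι_apply, Sum.elim_inl, Sum.elim_inr]
      exact gcomm_const X s α a ha
    | var_var s t =>
      simp only [map_mul, map_zsmul, FreeAlgebra.lift_ι_apply, Sum.elim_inr]
      exact gcomm_lin X s t⟩

@[simp] lemma substHom_const (X : degZeroMatrices A δ) (a : A) :
    substHom X (const A δ a) = const A δ a := by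
  refine (RingQuot.liftAlgHom_mkAlgHom_apply K _ _ _).trans ?_
  simp

@[simp] lemma substHom_var (X : degZeroMatrices A δ) (t : σ) :
    substHom X (var A δ t) = ∑ s, var A δ s * const A δ (X.1 s t) := by
  refine (RingQuot.liftAlgHom_mkAlgHom_apply K _ _ _).trans ?_
  simp

/-- The action of matrices of degree `0` on the polynomial algebra. -/
def subst : degZeroMatrices A δ →* (GradedPoly A δ →ₐ[K] GradedPoly A δ) where
  toFun := substHom
  map_one' := algHom_ext (fun a => by simp) fun t => by
    simp [Matrix.one_apply]
  map_mul' X Y := algHom_ext (fun a => by simp [AlgHom.mul_apply]) fun t => by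
    simp only [AlgHom.mul_apply, substHom_var, map_sum, map_mul, substHom_const,
      Subring.coe_mul, Matrix.mul_apply, Finset.mul_sum, Finset.sum_mul, mul_assoc]
    rw [Finset.sum_comm]

end Polynomials

section Transpose

variable {σ : Type} [Fintype σ] [DecidableEq σ] {A : GradedCommAlg.{u} K n} {δ : σ → Deg n}

lemma gradedTranspose_one : gradedTranspose (1 : degZeroMatrices A δ) = 1 := by
  apply Subtype.ext
  ext i j
  by_cases h : i = j
  · subst h
    have e : form (δ i + δ i) (δ i) = 0 := by rw [deg_add_self]; simp [form]
    simp [gradedTranspose, e, sgn]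
  · simp [gradedTranspose, Matrix.one_apply_ne h, Matrix.one_apply_ne (Ne.symm h)]

lemma gradedTranspose_mul (X Y : degZeroMatrices A δ) :
    gradedTranspose (X * Y) = gradedTranspose Y * gradedTranspose X := by
  apply Subtype.ext
  ext k i
  simp only [gradedTranspose, Subring.coe_mul, Matrix.mul_apply, Finset.smul_sum]
  refine Finset.sum_congr rfl fun j _ => ?_
  rw [smul_mul_assoc, mul_smul_comm, A.comm _ _ _ _ (Y.2 j k) (X.2 i j), smul_smul, smul_smul,
    ← sgn_add, ← sgn_add]
  congr 2
  simp only [form_add_left, form_add_right, form_comm (δ j) (δ k), form_comm (δ j) (δ i),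
    form_comm (δ k) (δ i)]
  generalize form (δ i) (δ k) = a
  generalize form (δ k) (δ k) = b
  generalize form (δ k) (δ j) = c
  generalize form (δ j) (δ j) = d
  generalize form (δ i) (δ j) = e
  revert a b c d e
  decide

end Transpose

section Complex

variable {N : ℕ} (A : GradedCommAlg.{u} K n) (deg : Fin N → Deg n) (π : Deg n)

/-- The degrees of the variables `Πeᵢ` (written `inl i`), namely `|eᵢ| + π`, and of the dual
variables `εⁱ` (written `inr i`), namely `|eᵢ|`. -/
def koszulDeg : Fin N ⊕ Fin N → Deg n := Sum.elim (fun i => deg i + π) deg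

/-- The total space `S_A(ΠM ⊕ M*)` of the complex, for `M` free with a basis of degrees `deg`. -/
abbrev KoszulSpace : Type (max u v) := GradedPoly A (koszulDeg deg π)

/-- The variable `Πeᵢ`. -/
abbrev parityVar (i : Fin N) : KoszulSpace A deg π := var A _ (Sum.inl i)

/-- The variable `εⁱ`. -/
abbrev dualVar (i : Fin N) : KoszulSpace A deg π := var A _ (Sum.inr i)

/-- The even variables `xᵢ`. -/
def evenVar (i : Fin N) : KoszulSpace A deg π :=
  if IsEven (deg i) then dualVar A deg π i else parityVar A deg π i

/-- The odd variables `ξᵢ`. -/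
def oddVar (i : Fin N) : KoszulSpace A deg π :=
  if IsEven (deg i) then parityVar A deg π i
  else -(sgn (form (deg i) π) • dualVar A deg π i)

/-- The element `∑ᵢ Πeᵢ εⁱ`. -/
def dElem : KoszulSpace A deg π := ∑ i, parityVar A deg π i * dualVar A deg π i

/-- The differential: left multiplication by `∑ᵢ Πeᵢ εⁱ`. -/
def d : KoszulSpace A deg π →ₗ[Aᵐᵒᵖ] KoszulSpace A deg π where
  toFun p := dElem A deg π * p
  map_add' := mul_add _
  map_smul' a p := (mul_assoc (dElem A deg π) p (const A _ a.unop)).symm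

/-- The `k`-cochains: the polynomials of total degree `k` in the variables `ξ`. -/
def cochains (k : ℕ) : Submodule Aᵐᵒᵖ (KoszulSpace A deg π) :=
  Submodule.span Aᵐᵒᵖ {p | ∃ l l' : List (Fin N), l.length = k ∧
    p = (l.map (oddVar A deg π)).prod * (l'.map (evenVar A deg π)).prod}

/-- The `k`-cocycles. -/
def cocycles (k : ℕ) : Submodule Aᵐᵒᵖ (KoszulSpace A deg π) :=
  cochains A deg π k ⊓ LinearMap.ker (d A deg π)

/-- The `k`-coboundaries. -/
def coboundaries : ℕ → Submodule Aᵐᵒᵖ (KoszulSpace A deg π)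
  | 0 => ⊥
  | k + 1 => (cochains A deg π k).map (d A deg π)

/-- The cohomology `Hᵏ`, a right `A`-module. -/
abbrev Cohomology (k : ℕ) : Type (max u v) :=
  cocycles A deg π k ⧸ (coboundaries A deg π k).submoduleOf (cocycles A deg π k)

/-- The cohomology `ker d / im d` of the total space. -/
abbrev TotalCohomology : Type (max u v) :=
  LinearMap.ker (d A deg π) ⧸ (LinearMap.range (d A deg π)).submoduleOf (LinearMap.ker (d A deg π))

lemma coboundaries_le (k : ℕ) : coboundaries A deg π k ≤ LinearMap.range (d A deg π) := by
  cases k with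
  | zero => exact bot_le
  | succ k => exact LinearMap.map_le_range

/-- The canonical map `Hᵏ → ker d / im d`. -/
def toTotal (k : ℕ) : Cohomology A deg π k →ₗ[Aᵐᵒᵖ] TotalCohomology A deg π :=
  Submodule.mapQ _ _ (Submodule.inclusion (inf_le_right : cocycles A deg π k ≤ _))
    fun _ hp => coboundaries_le A deg π k hp

/-- The product `ξ₁ ⋯ ξᵣ`. -/
def topElem : KoszulSpace A deg π := (List.ofFn (oddVar A deg π)).prod

variable {A deg}

/-- The matrix of the action on `ΠM ⊕ M*`: `T` on `ΠM`, and the graded transpose of `T⁻¹`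
on `M*`. -/
def actionMatrix : GLZero A deg →* degZeroMatrices A (koszulDeg deg π) where
  toFun T := ⟨Matrix.fromBlocks T.val.1 0 0 (gradedTranspose (T⁻¹).val).1, by
    rintro (i | i) (j | j)
    · have h := T.val.2 i j
      have e : deg i + π + (deg j + π) = deg i + deg j := by
        rw [add_add_add_comm, deg_add_self, add_zero]
      simpa [koszulDeg, e] using h
    · exact Submodule.zero_mem _
    · exact Submodule.zero_mem _
    · exact (gradedTranspose (T⁻¹).val).2 i j⟩
  map_one' := by
    apply Subtype.ext
    simp [gradedTranspose_one]
  map_mul' S T := by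
    apply Subtype.ext
    simp [gradedTranspose_mul, Matrix.fromBlocks_multiply]

/-- The action of `GL⁰` on the total space by `A`-algebra automorphisms. -/
def action : GLZero A deg →* (KoszulSpace A deg π →ₐ[K] KoszulSpace A deg π) :=
  subst.comp (actionMatrix π)

lemma action_dElem (T : GLZero A deg) : action π T (dElem A deg π) = dElem A deg π := by
  have h1 : ∀ i, action π T (parityVar A deg π i) =
      ∑ j, parityVar A deg π j * const A _ (T.val.1 j i) := fun i => by
    refine (substHom_var _ _).trans ?_
    simp [actionMatrix, Fintype.sum_sum_type]
  have h2 : ∀ i, action π T (dualVar A deg π i) =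
      ∑ k, dualVar A deg π k * const A _ ((gradedTranspose (T⁻¹).val).1 k i) := fun i => by
    refine (substHom_var _ _).trans ?_
    simp [actionMatrix, Fintype.sum_sum_type]
  have h3 : ∀ i j k, parityVar A deg π j * const A _ (T.val.1 j i) *
      (dualVar A deg π k * const A _ ((gradedTranspose (T⁻¹).val).1 k i)) =
      sgn (form (deg j + deg k) (deg k)) • (parityVar A deg π j * dualVar A deg π k *
        const A _ (T.val.1 j i * (T⁻¹).val.1 i k)) := fun i j k => by
    have h : const A _ (T.val.1 j i) * dualVar A deg π k =
        sgn (form (deg j + deg i) (deg k)) • (dualVar A deg π k * const A _ (T.val.1 j i)) :=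
      GComm.symm (α := deg k) (β := deg j + deg i)
        (var_mul_const (Sum.inr k) (deg j + deg i) _ (T.val.2 j i))
    rw [mul_assoc, ← mul_assoc (const A _ _), h]
    simp only [gradedTranspose, map_zsmul, mul_smul_comm, smul_mul_assoc, smul_smul, ← sgn_add,
      map_mul, mul_assoc]
    congr 2
    simp only [form_add_left]
    generalize form (deg i) (deg k) = a
    generalize form (deg j) (deg k) = b
    generalize form (deg k) (deg k) = c
    revert a b c
    decide
  have h4 : ∀ j k, ∑ i, T.val.1 j i * (T⁻¹).val.1 i k = (1 : Matrix (Fin N) (Fin N) A) j k :=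
    fun j k => by
      rw [← Matrix.mul_apply, ← Subring.coe_mul, Units.mul_inv, Subring.coe_one]
  calc action π T (dElem A deg π)
      = ∑ i, ∑ j, ∑ k, sgn (form (deg j + deg k) (deg k)) •
          (parityVar A deg π j * dualVar A deg π k *
            const A _ (T.val.1 j i * (T⁻¹).val.1 i k)) := by
        simp only [dElem, map_sum, map_mul, h1, h2, Finset.sum_mul_sum]
        simp only [h3, map_mul]
    _ = ∑ j, ∑ k, sgn (form (deg j + deg k) (deg k)) •
          (parityVar A deg π j * dualVar A deg π k *
            const A _ ((1 : Matrix (Fin N) (Fin N) A) j k)) := by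
        rw [Finset.sum_comm]
        refine Finset.sum_congr rfl fun j _ => ?_
        rw [Finset.sum_comm]
        refine Finset.sum_congr rfl fun k _ => ?_
        rw [← Finset.smul_sum, ← Finset.mul_sum, ← map_sum, h4]
    _ = dElem A deg π := by
        refine Finset.sum_congr rfl fun j _ => ?_
        rw [Finset.sum_eq_single j]
        · rw [Matrix.one_apply_eq, deg_add_self]
          simp [form, sgn]
        · intro k _ hk
          rw [Matrix.one_apply_ne (Ne.symm hk)]
          simp
        · simp

lemma action_const (T : GLZero A deg) (a : A) :
    action π T (const A _ a) = const A _ a := substHom_const _ a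

/-- The action on the total space as a right `A`-linear map. -/
def actionLinear (T : GLZero A deg) : KoszulSpace A deg π →ₗ[Aᵐᵒᵖ] KoszulSpace A deg π where
  toFun := action π T
  map_add' := map_add _
  map_smul' a p := by
    have h : action π T (p * const A _ a.unop) = action π T p * const A _ a.unop := by
      rw [map_mul, action_const]
    exact h

lemma action_d (T : GLZero A deg) (p : KoszulSpace A deg π) :
    action π T (d A deg π p) = d A deg π (action π T p) := by
  change action π T (dElem A deg π * p) = dElem A deg π * action π T p
  rw [map_mul, action_dElem]

lemma actionLinear_ker (T : GLZero A deg) :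
    ∀ p ∈ LinearMap.ker (d A deg π), actionLinear π T p ∈ LinearMap.ker (d A deg π) := by
  intro p hp
  rw [LinearMap.mem_ker] at hp ⊢
  exact (action_d π T p).symm.trans (by rw [hp, map_zero])

/-- The induced action `Φ` of `GL⁰` on the cohomology `ker d / im d`. -/
def Phi : GLZero A deg →* Module.End Aᵐᵒᵖ (TotalCohomology A deg π) where
  toFun T := Submodule.mapQ _ _ ((actionLinear π T).restrict (actionLinear_ker π T)) (by
    rintro ⟨p, hp⟩ ⟨q, hq⟩
    exact ⟨action π T q, (action_d π T q).symm.trans (congrArg (action π T) hq)⟩)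
  map_one' := by
    apply Submodule.linearMap_qext
    apply LinearMap.ext
    intro p
    simp only [LinearMap.comp_apply, Submodule.mkQ_apply, Submodule.mapQ_apply]
    congr 1
    apply Subtype.ext
    change action π 1 p.1 = p.1
    rw [map_one]
    rfl
  map_mul' S T := by
    apply Submodule.linearMap_qext
    apply LinearMap.ext
    intro p
    simp only [LinearMap.comp_apply, Submodule.mkQ_apply, Submodule.mapQ_apply, Module.End.mul_apply]
    congr 1
    apply Subtype.ext
    change action π (S * T) p.1 = action π S (action π T p.1)
    rw [map_mul]
    rfl

end Complex

end GradedKoszul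

open GradedKoszul

/-! Write D = ∑ ξᵢxᵢ for the element defining the differential and h = ∑ ∂/∂εⁱ ∂/∂Πeᵢ. Then Dh + hD
= N + (number of x) − (number of ξ) (`homotopy_formula`), an operator that is diagonal on monomials.
Since every ξᵢ squares to zero, the only nonvanishing monomial with eigenvalue zero is ξ₁⋯ξ_N up to
sign and coefficients; away from it the operator is invertible. Hence every cocycle is a multiple of
ξ₁⋯ξ_N plus a coboundary (`exists_of_dElem_mul_eq_zero`). Conversely `topCoeff`, which
differentiates once in each ξᵢ and evaluates at zero, vanishes on multiples of D and equals 1 on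
ξ₁⋯ξ_N. So the cohomology is free of rank one.

The group GL⁰ therefore acts through a scalar, `cohBer`: the top coefficient of φ_T(ξ₁⋯ξ_N). It is
multiplicative, of degree zero and natural in the algebra. What remains is that it has the
prescribed values and that these values determine a unique family.

Both rest on rigidity of homomorphisms from GL⁰ to commutative groups. An elementary column matrix
is conjugate to its square, because 2 is invertible, so it maps to 1 (`map_colUnit`); this already
settles unitriangular matrices. If A⁰ is local, Gaussian elimination generates GL⁰ by elementary
column matrices and diagonal ones, so a homomorphism is known from its diagonal values
(`hom_ext_of_isLocalRing`). Equality in A⁰ can be tested in localizations at maximal ideals of A⁰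
(`eq_of_local`), and naturality carries the question there. Uniqueness follows. For block-diagonal
matrices, the entries lie in A⁰, viewed as an algebra concentrated in degree zero; there the
determinant expression is itself a homomorphism and can be compared with `cohBer` on diagonal
matrices. -/

namespace GradedKoszul

open scoped RightActions

variable {K : Type v} [Field K] {n : ℕ}

/-! ### Sign automorphisms of a graded-commutative algebra -/

section Twist

lemma sgn_eq (z : ZMod 2) : sgn z = 1 ∨ sgn z = -1 := by
  revert z; decide

lemma form_zero_left (x : Deg n) : form 0 x = 0 := by simp [form]

lemma form_zero_right (x : Deg n) : form x 0 = 0 := by simp [form]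

lemma isEven_iff_not_isOdd (γ : Deg n) : ¬ IsEven γ ↔ IsOdd γ := by
  have h : ∀ z : ZMod 2, ¬ z = 0 ↔ z = 1 := by decide
  exact h _

/-- A property stable under addition that holds for homogeneous elements holds everywhere. -/
lemma GradedCommAlg.induction (A : GradedCommAlg.{u} K n) {p : A → Prop}
    (hom : ∀ γ, ∀ a ∈ A.grading γ, p a) (add : ∀ a b, p a → p b → p (a + b)) (a : A) : p a :=
  DirectSum.Decomposition.inductionOn A.grading (hom 0 0 (Submodule.zero_mem _))
    (fun a => hom _ _ a.2) add a

variable (A : GradedCommAlg.{u} K n)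

/-- The sign automorphism attached to a degree `β`, as a linear map. -/
noncomputable def twistLin (β : Deg n) : A →ₗ[K] A :=
  ∑ γ, sgn (form β γ) • GradedAlgebra.proj A.grading γ

variable {A}

lemma twistLin_of_mem {β γ : Deg n} {a : A} (ha : a ∈ A.grading γ) :
    twistLin A β a = sgn (form β γ) • a := by
  rw [twistLin, LinearMap.sum_apply, Finset.sum_eq_single γ]
  · simp [GradedAlgebra.proj_apply, DirectSum.decompose_of_mem_same _ ha]
  · intro γ' _ h
    simp [GradedAlgebra.proj_apply, DirectSum.decompose_of_mem_ne _ ha h.symm]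
  · simp

variable (A) in
/-- The sign automorphism attached to a degree `β`: it multiplies a homogeneous element of degree
`γ` by `(-1)^⟨β, γ⟩`. -/
noncomputable def twist (β : Deg n) : A →ₐ[K] A :=
  AlgHom.ofLinearMap (twistLin A β)
    (by rw [twistLin_of_mem SetLike.GradedOne.one_mem, form_zero_right, sgn_zero, one_smul])
    (fun a b => by
      induction a using A.induction with
      | hom α a ha =>
        induction b using A.induction with
        | hom α' b hb =>
          rw [twistLin_of_mem ha, twistLin_of_mem hb,
            twistLin_of_mem (SetLike.GradedMul.mul_mem ha hb), form_add_right, sgn_add,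
            smul_mul_smul_comm]
        | add b b' h h' => rw [mul_add, map_add, map_add, h, h', mul_add]
      | add a a' h h' => rw [add_mul, map_add, map_add, h, h', add_mul])

lemma twist_of_mem {β γ : Deg n} {a : A} (ha : a ∈ A.grading γ) :
    twist A β a = sgn (form β γ) • a := twistLin_of_mem ha

/-- Nondegeneracy of the form: pairing with a coordinate vector reads off a coordinate. -/
lemma exists_form_ne_zero {γ : Deg n} (h : γ ≠ 0) : ∃ β : Deg n, form β γ = 1 := by
  obtain ⟨i, hi⟩ := Function.ne_iff.mp h
  have h1 : ∀ z : ZMod 2, z ≠ 0 → z = 1 := by decide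
  exact ⟨Pi.single i 1, by simp [form, Pi.single_apply, h1 _ hi]⟩

/-- An element fixed by all sign automorphisms has degree zero. -/
lemma mem_zero_of_twist [CharZero K] {a : A} (h : ∀ β, twist A β a = a) : a ∈ A.grading 0 := by
  -- For β with ⟨β, γ⟩ = 1, invariance under the twist by β makes the component of degree γ equal to
  -- its own negative, hence zero in characteristic zero.
  have key : ∀ γ, γ ≠ 0 → GradedAlgebra.proj A.grading γ a = 0 := by
    intro γ hγ
    obtain ⟨β, hβ⟩ := exists_form_ne_zero hγ
    have hp : ∀ a : A, GradedAlgebra.proj A.grading γ (twist A β a)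
        = sgn (form β γ) • GradedAlgebra.proj A.grading γ a := by
      refine A.induction (fun α a ha => ?_) (fun a b h h' => ?_)
      · rw [twist_of_mem ha, map_zsmul]
        by_cases hα : α = γ
        · rw [hα]
        · simp [GradedAlgebra.proj_apply, DirectSum.decompose_of_mem_ne _ ha hα]
      · rw [map_add, map_add, map_add, h, h', smul_add]
    have h1 := hp a
    rw [h β, hβ, show sgn 1 = -1 from rfl, neg_one_smul] at h1
    have h2 : (2 : K) • GradedAlgebra.proj A.grading γ a = 0 := by
      rw [two_smul]
      nth_rewrite 1 [h1]
      exact neg_add_cancel _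
    exact (smul_eq_zero.mp h2).resolve_left two_ne_zero
  classical
  rw [← DirectSum.sum_support_decompose A.grading a]
  refine Submodule.sum_mem _ fun γ _ => ?_
  by_cases hγ : γ = 0
  · subst hγ; exact SetLike.coe_mem _
  · have := key γ hγ
    rw [GradedAlgebra.proj_apply] at this
    rw [this]
    exact Submodule.zero_mem _

/-- Elements of degree zero are central. -/
lemma zero_comm {a : A} (ha : a ∈ A.grading 0) (b : A) : a * b = b * a := by
  refine A.induction (p := fun b => a * b = b * a) (fun γ b hb => ?_) (fun b b' h h' => ?_) b
  · rw [A.comm _ _ _ _ ha hb, form_zero_left, sgn_zero, one_smul]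
  · rw [mul_add, add_mul, h, h']

end Twist

/-! ### Universal property of the polynomial algebra -/

section Lift

variable {σ : Type} {A : GradedCommAlg.{u} K n} {δ : σ → Deg n}

/-- The universal property of the graded-commutative polynomial algebra. -/
def liftPoly {C : Type*} [Ring C] [Algebra K C] (f : A →ₐ[K] C) (g : σ → C)
    (hc : ∀ s α, ∀ a ∈ A.grading α, g s * f a = sgn (form (δ s) α) • (f a * g s))
    (hv : ∀ s t, g s * g t = sgn (form (δ s) (δ t)) • (g t * g s)) : GradedPoly A δ →ₐ[K] C :=
  RingQuot.liftAlgHom K (s := PolyRel A δ)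
    ⟨FreeAlgebra.lift K (Sum.elim (fun a => f a) g), by
    intro p q h
    induction h with
    | const_add a b => simp
    | const_mul a b => simp
    | const_scalar c => simp [AlgHom.commutes]
    | var_const s α a ha =>
      simp only [map_mul, map_zsmul, FreeAlgebra.lift_ι_apply, Sum.elim_inl, Sum.elim_inr]
      exact hc s α a ha
    | var_var s t =>
      simp only [map_mul, map_zsmul, FreeAlgebra.lift_ι_apply, Sum.elim_inr]
      exact hv s t⟩

section
variable {C : Type*} [Ring C] [Algebra K C] (f : A →ₐ[K] C) (g : σ → C)
    (hc : ∀ s α, ∀ a ∈ A.grading α, g s * f a = sgn (form (δ s) α) • (f a * g s))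
    (hv : ∀ s t, g s * g t = sgn (form (δ s) (δ t)) • (g t * g s))

@[simp] lemma liftPoly_const (a : A) : liftPoly f g hc hv (const A δ a) = f a := by
  refine (RingQuot.liftAlgHom_mkAlgHom_apply K _ _ _).trans ?_
  simp

@[simp] lemma liftPoly_var (s : σ) : liftPoly f g hc hv (var A δ s) = g s := by
  refine (RingQuot.liftAlgHom_mkAlgHom_apply K _ _ _).trans ?_
  simp

end

lemma GradedPoly.induction {p : GradedPoly A δ → Prop} (hc : ∀ a, p (const A δ a))
    (hv : ∀ s, p (var A δ s)) (hadd : ∀ x y, p x → p y → p (x + y))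
    (hmul : ∀ x y, p x → p y → p (x * y)) (x : GradedPoly A δ) : p x := by
  obtain ⟨y, rfl⟩ := RingQuot.mkAlgHom_surjective K (PolyRel A δ) x
  induction y using FreeAlgebra.induction with
  | grade0 r =>
    have h := hc (algebraMap K A r)
    rw [AlgHom.commutes] at h
    rw [AlgHom.commutes]
    exact h
  | grade1 x =>
    rcases x with a | s
    · exact hc a
    · exact hv s
  | mul a b ha hb => rw [map_mul]; exact hmul _ _ ha hb
  | add a b ha hb => rw [map_add]; exact hadd _ _ ha hb

variable (A δ) in
/-- The sign automorphism of the polynomial algebra attached to a degree `β`. -/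
noncomputable def polyTwist (β : Deg n) : GradedPoly A δ →ₐ[K] GradedPoly A δ :=
  liftPoly ((const A δ).comp (twist A β)) (fun s => sgn (form β (δ s)) • var A δ s)
    (fun s α a ha => by
      simp only [AlgHom.comp_apply, twist_of_mem ha, map_zsmul, smul_mul_smul_comm,
        var_mul_const s α a ha, smul_smul]
      congr 1
      ring)
    (fun s t => by
      simp only [smul_mul_smul_comm, var_mul_var s t, smul_smul]
      congr 1
      ring)

@[simp] lemma polyTwist_const (β : Deg n) (a : A) :
    polyTwist A δ β (const A δ a) = const A δ (twist A β a) := by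
  simp [polyTwist]

@[simp] lemma polyTwist_var (β : Deg n) (s : σ) :
    polyTwist A δ β (var A δ s) = sgn (form β (δ s)) • var A δ s := by
  simp [polyTwist]

/-- Graded commutation with a variable, in a form that applies to inhomogeneous p: all the signs are
collected in the automorphism attached to the degree of the variable. -/
lemma mul_var (s : σ) (p : GradedPoly A δ) :
    p * var A δ s = var A δ s * polyTwist A δ (δ s) p := by
  induction p using GradedPoly.induction with
  | hc a =>
    induction a using A.induction with
    | hom α a ha =>
      rw [polyTwist_const, twist_of_mem ha, map_zsmul, mul_smul_comm, var_mul_const s α a ha,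
        smul_smul, sgn_mul_self, one_smul]
    | add a b h h' => rw [map_add, add_mul, map_add, mul_add, h, h']
  | hv t => rw [polyTwist_var, mul_smul_comm, var_mul_var t s, form_comm]
  | hadd x y hx hy => rw [add_mul, hx, hy, map_add, mul_add]
  | hmul x y hx hy => rw [mul_assoc, hy, ← mul_assoc, hx, map_mul, mul_assoc]

variable (A δ) in
/-- Evaluation of polynomials at zero. -/
def evalZero : GradedPoly A δ →ₐ[K] A :=
  liftPoly (AlgHom.id K A) (fun _ => 0) (by simp) (by simp)

@[simp] lemma evalZero_const (a : A) : evalZero A δ (const A δ a) = a := by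
  simp [evalZero]

@[simp] lemma evalZero_var (s : σ) : evalZero A δ (var A δ s) = 0 := by
  simp [evalZero]

lemma polyTwist_evalZero (β : Deg n) (p : GradedPoly A δ) :
    evalZero A δ (polyTwist A δ β p) = twist A β (evalZero A δ p) := by
  have h : (evalZero A δ).comp (polyTwist A δ β) = (twist A β).comp (evalZero A δ) :=
    algHom_ext (by simp) (by simp)
  exact DFunLike.congr_fun h p

end Lift

/-! ### Graded partial derivatives and number operators -/

section Derivative

variable {σ : Type} [DecidableEq σ] {A : GradedCommAlg.{u} K n} {δ : σ → Deg n}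

lemma fin_two_ext {R : Type*} {M N : Matrix (Fin 2) (Fin 2) R} (h00 : M 0 0 = N 0 0)
    (h01 : M 0 1 = N 0 1) (h10 : M 1 0 = N 1 0) (h11 : M 1 1 = N 1 1) : M = N := by
  ext i j
  fin_cases i <;> fin_cases j <;> assumption

variable (A δ) in
/-- The algebra homomorphism to `2 × 2`-matrices whose upper right entry is the graded partial
derivative with respect to the variable `s`. -/
noncomputable def pderivHom (s : σ) :
    GradedPoly A δ →ₐ[K] Matrix (Fin 2) (Fin 2) (GradedPoly A δ) :=
  -- In upper triangular matrices with diagonal (twist of p, p), the corner of a product obeys the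
  -- graded Leibniz rule. So the derivative is the corner of an algebra homomorphism, and its
  -- existence reduces to checking the relations on generators.
  liftPoly
    ((Matrix.diagonalAlgHom K).comp (AlgHom.pi
      (fun i : Fin 2 => if i = 0 then (const A δ).comp (twist A (δ s)) else const A δ)))
    (fun t => !![sgn (form (δ s) (δ t)) • var A δ t, if t = s then 1 else 0; 0, var A δ t])
    (fun t α a ha => by
      have h := var_mul_const (δ := δ) t α a ha
      apply fin_two_ext
      · simp [-zsmul_eq_mul, Matrix.mul_apply, Fin.sum_univ_two, twist_of_mem ha, h, smul_smul]
        congr 1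
        ring
      · by_cases hts : t = s
        · subst hts
          simp [-zsmul_eq_mul, Matrix.mul_apply, Fin.sum_univ_two, twist_of_mem ha, smul_smul,
            sgn_mul_self]
        · simp [-zsmul_eq_mul, Matrix.mul_apply, Fin.sum_univ_two, hts]
      · simp [Matrix.mul_apply, Fin.sum_univ_two]
      · simp [-zsmul_eq_mul, Matrix.mul_apply, Fin.sum_univ_two, h])
    (fun t t' => by
      have h := var_mul_var (A := A) (δ := δ) t t'
      apply fin_two_ext
      · rw [Matrix.smul_apply, Matrix.mul_apply, Matrix.mul_apply]
        simp [-zsmul_eq_mul, Fin.sum_univ_two, h, smul_smul]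
        congr 1
        ring
      · by_cases hts : t = s <;> by_cases hts' : t' = s
        · subst hts; subst hts'
          simp [-zsmul_eq_mul, Matrix.mul_apply, Fin.sum_univ_two, smul_smul, sgn_mul_self,
            add_comm]
        · subst hts
          simp [-zsmul_eq_mul, Matrix.mul_apply, Fin.sum_univ_two, smul_smul, sgn_mul_self, hts']
        · subst hts'
          simp [-zsmul_eq_mul, Matrix.mul_apply, Fin.sum_univ_two, hts, form_comm]
        · simp [Matrix.mul_apply, Fin.sum_univ_two, hts, hts']
      · simp [Matrix.mul_apply, Fin.sum_univ_two]
      · simp [-zsmul_eq_mul, Matrix.mul_apply, Fin.sum_univ_two, h])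

lemma pderivHom_const (s : σ) (a : A) : pderivHom A δ s (const A δ a) =
    !![const A δ (twist A (δ s) a), 0; 0, const A δ a] := by
  rw [pderivHom, liftPoly_const]
  ext i j
  fin_cases i <;> fin_cases j <;> simp

lemma pderivHom_var (s t : σ) : pderivHom A δ s (var A δ t) =
    !![sgn (form (δ s) (δ t)) • var A δ t, if t = s then 1 else 0; 0, var A δ t] := by
  rw [pderivHom, liftPoly_var]

variable (A δ) in
/-- The graded partial derivative with respect to the variable `s`. -/
noncomputable def pderiv (s : σ) : GradedPoly A δ →ₗ[K] GradedPoly A δ :=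
  (Matrix.entryLinearMap K _ 0 1).comp (pderivHom A δ s).toLinearMap

lemma pderiv_apply (s : σ) (p : GradedPoly A δ) : pderiv A δ s p = pderivHom A δ s p 0 1 := rfl

lemma pderivHom_eq (s : σ) (p : GradedPoly A δ) :
    pderivHom A δ s p = !![polyTwist A δ (δ s) p, pderiv A δ s p; 0, p] := by
  induction p using GradedPoly.induction with
  | hc a => rw [pderiv_apply, pderivHom_const]; simp
  | hv t => rw [pderiv_apply, pderivHom_var]; simp
  | hadd x y hx hy =>
    rw [map_add, map_add, map_add, hx, hy]
    ext i j
    fin_cases i <;> fin_cases j <;> simp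
  | hmul x y hx hy =>
    rw [pderiv_apply, map_mul, map_mul, hx, hy]
    ext i j
    fin_cases i <;> fin_cases j <;> simp [Matrix.mul_apply, Fin.sum_univ_two]

lemma pderiv_mul (s : σ) (p q : GradedPoly A δ) :
    pderiv A δ s (p * q) = polyTwist A δ (δ s) p * pderiv A δ s q + pderiv A δ s p * q := by
  rw [pderiv_apply, map_mul, pderivHom_eq, pderivHom_eq]
  simp [Matrix.mul_apply, Fin.sum_univ_two]

@[simp] lemma pderiv_const (s : σ) (a : A) : pderiv A δ s (const A δ a) = 0 := by
  rw [pderiv_apply, pderivHom_const]; simp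

lemma pderiv_var (s t : σ) : pderiv A δ s (var A δ t) = if t = s then 1 else 0 := by
  rw [pderiv_apply, pderivHom_var]; simp

lemma pderiv_mul_const (s : σ) (p : GradedPoly A δ) (a : A) :
    pderiv A δ s (p * const A δ a) = pderiv A δ s p * const A δ a := by
  rw [pderiv_mul, pderiv_const, mul_zero, zero_add]

lemma pderiv_var_mul_of_ne {s t : σ} (h : t ≠ s) (p : GradedPoly A δ) :
    pderiv A δ s (var A δ t * p) = sgn (form (δ s) (δ t)) • (var A δ t * pderiv A δ s p) := by
  rw [pderiv_mul, pderiv_var, if_neg h, zero_mul, add_zero, polyTwist_var, smul_mul_assoc]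

lemma pderiv_var_mul_self (s : σ) (p : GradedPoly A δ) :
    pderiv A δ s (var A δ s * p) = p + sgn (form (δ s) (δ s)) • (var A δ s * pderiv A δ s p) := by
  rw [pderiv_mul, pderiv_var, if_pos rfl, one_mul, polyTwist_var, smul_mul_assoc, add_comm]

lemma pderiv_polyTwist (β : Deg n) (s : σ) (p : GradedPoly A δ) :
    pderiv A δ s (polyTwist A δ β p) =
      sgn (form β (δ s)) • polyTwist A δ β (pderiv A δ s p) := by
  have hcomm : ∀ p, polyTwist A δ (δ s) (polyTwist A δ β p) =
      polyTwist A δ β (polyTwist A δ (δ s) p) := by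
    intro p
    have h : (polyTwist A δ (δ s)).comp (polyTwist A δ β) =
        (polyTwist A δ β).comp (polyTwist A δ (δ s)) := by
      refine algHom_ext (fun a => ?_) (fun t => ?_)
      · simp only [AlgHom.comp_apply, polyTwist_const]
        induction a using A.induction with
        | hom α a ha =>
          simp only [twist_of_mem ha, map_zsmul]
          rw [smul_comm]
        | add a b h h' => simp only [map_add, h, h']
      · simp only [AlgHom.comp_apply, polyTwist_var, map_zsmul]
        rw [smul_comm]
    exact DFunLike.congr_fun h p
  induction p using GradedPoly.induction with
  | hc a => simp
  | hv t =>
    rw [polyTwist_var, map_zsmul, pderiv_var]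
    by_cases h : t = s
    · simp [h]
    · simp [h]
  | hadd x y hx hy => rw [map_add, map_add, map_add, map_add, hx, hy, smul_add]
  | hmul x y hx hy =>
    rw [map_mul, pderiv_mul, pderiv_mul, hx, hy, map_add, map_mul, map_mul, smul_add, hcomm,
      mul_smul_comm, smul_mul_assoc]

variable (A δ) in
/-- The number operator of the variable `s`. -/
noncomputable def numOp (s : σ) : GradedPoly A δ →ₗ[K] GradedPoly A δ :=
  (LinearMap.mulLeft K (var A δ s)).comp (pderiv A δ s)

lemma numOp_apply (s : σ) (p : GradedPoly A δ) :
    numOp A δ s p = var A δ s * pderiv A δ s p := rfl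

/-- The twist in the Leibniz rule is absorbed when the variable moves back past p by `mul_var`, so
number operators are ordinary derivations. -/
lemma numOp_mul (s : σ) (p q : GradedPoly A δ) :
    numOp A δ s (p * q) = numOp A δ s p * q + p * numOp A δ s q := by
  simp only [numOp_apply, pderiv_mul, mul_add, ← mul_assoc]
  rw [mul_var s p, add_comm]

lemma numOp_var (s t : σ) : numOp A δ s (var A δ t) = if t = s then var A δ t else 0 := by
  rw [numOp_apply, pderiv_var]
  split_ifs with h
  · rw [h, mul_one]
  · rw [mul_zero]

end Derivative

/-! ### Equality up to sign -/

section SignEq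

/-- Equality up to sign. -/
def SignEq {R : Type*} [Ring R] (p q : R) : Prop := p = q ∨ p = -q

variable {R : Type*} [Ring R] {p q r : R}

lemma SignEq.refl (p : R) : SignEq p p := Or.inl rfl

lemma SignEq.symm (h : SignEq p q) : SignEq q p := by
  rcases h with rfl | rfl
  · exact Or.inl rfl
  · exact Or.inr (neg_neg q).symm

lemma SignEq.trans (h : SignEq p q) (h' : SignEq q r) : SignEq p r := by
  rcases h with rfl | rfl
  · exact h'
  · rcases h' with rfl | rfl
    · exact Or.inr rfl
    · exact Or.inl (neg_neg r)

lemma SignEq.mul_left (h : SignEq p q) (r : R) : SignEq (r * p) (r * q) := by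
  rcases h with rfl | rfl
  · exact Or.inl rfl
  · exact Or.inr (mul_neg r q)

lemma SignEq.mul_right (h : SignEq p q) (r : R) : SignEq (p * r) (q * r) := by
  rcases h with rfl | rfl
  · exact Or.inl rfl
  · exact Or.inr (neg_mul q r)

lemma SignEq.eq_zero (h : SignEq p q) (hq : q = 0) : p = 0 := by
  rcases h with rfl | rfl <;> simp [hq]

lemma SignEq.mem {S : Type*} [SetLike S R] [NegMemClass S R] {s : S} (h : SignEq p q)
    (hq : q ∈ s) : p ∈ s := by
  rcases h with rfl | rfl
  · exact hq
  · exact neg_mem hq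

lemma SignEq.sgn_smul (z : ZMod 2) (p : R) : SignEq (sgn z • p) p := by
  rcases sgn_eq z with h | h
  · exact Or.inl (by rw [h, one_smul])
  · exact Or.inr (by rw [h, neg_one_smul])

lemma SignEq.list_prod_perm {ι : Type*} {f : ι → R}
    (hf : ∀ i j, SignEq (f i * f j) (f j * f i)) {l l' : List ι} (h : l.Perm l') :
    SignEq (l.map f).prod (l'.map f).prod := by
  induction h with
  | nil => exact SignEq.refl _
  | cons i _ ih => simpa using ih.mul_left (f i)
  | swap i j l =>
    simpa [mul_assoc] using (hf j i).mul_right (l.map f).prod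
  | trans _ _ ih ih' => exact ih.trans ih'

lemma SignEq.mul_list_prod {ι : Type*} {f : ι → R} {p : R}
    (hf : ∀ i, SignEq (p * f i) (f i * p)) (l : List ι) :
    SignEq (p * (l.map f).prod) ((l.map f).prod * p) := by
  induction l with
  | nil => simpa using SignEq.refl p
  | cons i l ih =>
    have h1 := (hf i).mul_right (l.map f).prod
    have h2 := ih.mul_left (f i)
    simp only [List.map_cons, List.prod_cons, mul_assoc] at *
    exact h1.trans h2

end SignEq

/-! ### The variables ξ and x, and spanning by monomials -/

section Variables

variable {N : ℕ} {A : GradedCommAlg.{u} K n} {deg : Fin N → Deg n} {π : Deg n}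

variable (deg) in
/-- The index of the odd variable `ξᵢ`. -/
def oddIdx (i : Fin N) : Fin N ⊕ Fin N := if IsEven (deg i) then Sum.inl i else Sum.inr i

variable (deg) in
/-- The index of the even variable `xᵢ`. -/
def evenIdx (i : Fin N) : Fin N ⊕ Fin N := if IsEven (deg i) then Sum.inr i else Sum.inl i

variable (deg π) in
/-- The sign relating `ξᵢ` to a variable. -/
def oddSign (i : Fin N) : ℤ := if IsEven (deg i) then 1 else -sgn (form (deg i) π)

lemma oddSign_mul_self (i : Fin N) : oddSign deg π i * oddSign deg π i = 1 := by
  unfold oddSign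
  split_ifs
  · rfl
  · rw [neg_mul_neg, sgn_mul_self]

lemma oddVar_eq (i : Fin N) : oddVar A deg π i = oddSign deg π i • var A _ (oddIdx deg i) := by
  unfold oddVar oddSign oddIdx
  split_ifs
  · rw [one_smul]
  · rw [neg_smul]

lemma evenVar_eq (i : Fin N) : evenVar A deg π i = var A _ (evenIdx deg i) := by
  unfold evenVar evenIdx
  split_ifs <;> rfl

/-- Since ⟨γ + π, γ + π⟩ = ⟨γ, γ⟩ + 1, exactly one of Πeᵢ and εⁱ has odd degree; it is the one
underlying ξᵢ. -/
lemma form_oddIdx (hπ : IsOdd π) (i : Fin N) :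
    form (koszulDeg deg π (oddIdx deg i)) (koszulDeg deg π (oddIdx deg i)) = 1 := by
  unfold oddIdx
  split_ifs with h
  · simp only [koszulDeg, Sum.elim_inl, form_add_left, form_add_right, form_comm π (deg i),
      show form (deg i) (deg i) = 0 from h, show form π π = 1 from hπ]
    generalize form (deg i) π = z
    revert z; decide
  · exact (isEven_iff_not_isOdd _).mp h

lemma form_evenIdx (hπ : IsOdd π) (i : Fin N) :
    form (koszulDeg deg π (evenIdx deg i)) (koszulDeg deg π (evenIdx deg i)) = 0 := by
  unfold evenIdx
  split_ifs with h
  · exact h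
  · simp only [koszulDeg, Sum.elim_inl, form_add_left, form_add_right, form_comm π (deg i),
      show form (deg i) (deg i) = 1 from (isEven_iff_not_isOdd _).mp h,
      show form π π = 1 from hπ]
    generalize form (deg i) π = z
    revert z; decide

lemma oddIdx_injective : Function.Injective (oddIdx deg) := by
  intro i j h
  unfold oddIdx at h
  split_ifs at h <;> simpa using h

lemma evenIdx_ne_oddIdx (i j : Fin N) : evenIdx deg i ≠ oddIdx deg j := by
  intro h
  unfold oddIdx evenIdx at h
  split_ifs at h with h1 h2 h2 <;> simp only [Sum.inl.injEq, Sum.inr.injEq] at h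
  · exact h2 (h ▸ h1)
  · exact h1 (h ▸ h2)

lemma oddVar_mul_oddVar (i j : Fin N) :
    SignEq (oddVar A deg π i * oddVar A deg π j) (oddVar A deg π j * oddVar A deg π i) := by
  rw [oddVar_eq, oddVar_eq, smul_mul_smul_comm, smul_mul_smul_comm, var_mul_var,
    smul_comm, mul_comm]
  exact SignEq.sgn_smul _ _

lemma evenVar_mul_oddVar (i j : Fin N) :
    SignEq (evenVar A deg π i * oddVar A deg π j) (oddVar A deg π j * evenVar A deg π i) := by
  rw [oddVar_eq, evenVar_eq, mul_smul_comm, smul_mul_assoc, var_mul_var, smul_comm]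
  exact SignEq.sgn_smul _ _

lemma oddVar_sq [CharZero K] (hπ : IsOdd π) (i : Fin N) :
    oddVar A deg π i * oddVar A deg π i = 0 := by
  have h := var_mul_var (A := A) (δ := koszulDeg deg π) (oddIdx deg i) (oddIdx deg i)
  rw [form_oddIdx hπ, show sgn 1 = -1 from rfl, neg_one_smul] at h
  have h2 : (2 : K) • (var A (koszulDeg deg π) (oddIdx deg i) *
      var A (koszulDeg deg π) (oddIdx deg i)) = 0 := by
    rw [two_smul]
    nth_rewrite 1 [h]
    exact neg_add_cancel _
  rw [oddVar_eq, smul_mul_smul_comm, (smul_eq_zero.mp h2).resolve_left two_ne_zero, smul_zero]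

/-- The sign in the definition of ξᵢ for odd γᵢ is the one produced by interchanging Πeᵢ and εⁱ. -/
lemma dElem_eq :
    dElem A deg π = ∑ i, oddVar A deg π i * evenVar A deg π i := by
  refine Finset.sum_congr rfl fun i _ => ?_
  by_cases h : IsEven (deg i)
  · simp only [oddVar, evenVar, if_pos h]
  · have h' : form (deg i) (deg i) = 1 := (isEven_iff_not_isOdd _).mp h
    have hs : sgn (form (koszulDeg deg π (Sum.inl i)) (koszulDeg deg π (Sum.inr i))) =
        -sgn (form (deg i) π) := by
      simp only [koszulDeg, Sum.elim_inl, Sum.elim_inr, form_add_left, h', sgn_add, form_comm π]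
      exact neg_one_mul _
    simp only [oddVar, evenVar, if_neg h]
    rw [var_mul_var, hs, neg_smul, neg_mul, smul_mul_assoc]

variable (A π) in
/-- The product of the odd variables with indices in a list. -/
def oddProd (deg : Fin N → Deg n) (l : List (Fin N)) : KoszulSpace A deg π :=
  (l.map (oddVar A deg π)).prod

variable (A π) in
/-- The product of the even variables with indices in a list. -/
def evenProd (deg : Fin N → Deg n) (l : List (Fin N)) : KoszulSpace A deg π :=
  (l.map (evenVar A deg π)).prod

@[simp] lemma oddProd_nil : oddProd A π deg [] = 1 := rfl

@[simp] lemma evenProd_nil : evenProd A π deg [] = 1 := rfl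

lemma oddProd_cons (i : Fin N) (l : List (Fin N)) :
    oddProd A π deg (i :: l) = oddVar A deg π i * oddProd A π deg l := by
  simp [oddProd]

lemma evenProd_cons (i : Fin N) (l : List (Fin N)) :
    evenProd A π deg (i :: l) = evenVar A deg π i * evenProd A π deg l := by
  simp [evenProd]

lemma topElem_eq : topElem A deg π = oddProd A π deg (List.finRange N) := by
  rw [topElem, oddProd, List.ofFn_eq_map]

lemma oddProd_perm {l l' : List (Fin N)} (h : l.Perm l') :
    SignEq (oddProd A π deg l) (oddProd A π deg l') :=
  SignEq.list_prod_perm oddVar_mul_oddVar h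

lemma evenVar_mul_oddProd (i : Fin N) (l : List (Fin N)) :
    SignEq (evenVar A deg π i * oddProd A π deg l) (oddProd A π deg l * evenVar A deg π i) :=
  SignEq.mul_list_prod (evenVar_mul_oddVar i) l

lemma oddVar_mul_oddProd_of_mem [CharZero K] (hπ : IsOdd π) {i : Fin N} {l : List (Fin N)}
    (h : i ∈ l) : oddVar A deg π i * oddProd A π deg l = 0 := by
  refine ((oddProd_perm (List.perm_cons_erase h)).mul_left _).eq_zero ?_
  rw [oddProd_cons, ← mul_assoc, oddVar_sq hπ, zero_mul]

lemma oddProd_of_not_nodup [CharZero K] (hπ : IsOdd π) {l : List (Fin N)} (h : ¬ l.Nodup) :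
    oddProd A π deg l = 0 := by
  induction l with
  | nil => simp at h
  | cons i l ih =>
    rw [oddProd_cons]
    by_cases hi : i ∈ l
    · exact oddVar_mul_oddProd_of_mem hπ hi
    · rw [ih (fun hl => h (List.nodup_cons.mpr ⟨hi, hl⟩)), mul_zero]

lemma perm_finRange {l : List (Fin N)} (h : l.Nodup) (hl : N ≤ l.length) :
    l.Perm (List.finRange N) := by
  have h1 : l.toFinset = Finset.univ := by
    refine Finset.eq_univ_of_card _ (le_antisymm (Finset.card_le_univ _) ?_)
    rw [List.toFinset_card_of_nodup h, Fintype.card_fin]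
    exact hl
  refine (List.perm_ext_iff_of_nodup h (List.nodup_finRange N)).mpr fun i => ?_
  have : i ∈ l.toFinset := h1 ▸ Finset.mem_univ i
  simpa using this

/-- A product of at least `N` odd variables vanishes or is the top product up to sign. -/
lemma oddProd_of_length [CharZero K] (hπ : IsOdd π) {l : List (Fin N)} (hl : N ≤ l.length) :
    oddProd A π deg l = 0 ∨ l.length = N ∧ SignEq (oddProd A π deg l) (topElem A deg π) := by
  by_cases h : l.Nodup
  · have hp := perm_finRange h hl
    exact Or.inr ⟨by rw [hp.length_eq, List.length_finRange], topElem_eq (A := A) (deg := deg) ▸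
      oddProd_perm hp⟩
  · exact Or.inl (oddProd_of_not_nodup hπ h)

variable (A deg π) in
/-- The products `ξ ⋯ ξ x ⋯ x a`. -/
def monomials : Set (KoszulSpace A deg π) :=
  {p | ∃ l l' a, p = oddProd A π deg l * evenProd A π deg l' * const A _ a}

lemma const_mul_var {σ : Type} {δ : σ → Deg n} (s : σ) (a : A) :
    const A δ a * var A δ s = var A δ s * const A δ (twist A (δ s) a) := by
  rw [mul_var, polyTwist_const]

lemma const_mul_oddProd (l : List (Fin N)) (a : A) :
    ∃ b, const A _ a * oddProd A π deg l = oddProd A π deg l * const A _ b := by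
  induction l generalizing a with
  | nil => exact ⟨a, by simp⟩
  | cons i l ih =>
    obtain ⟨b, hb⟩ := ih (twist A (koszulDeg deg π (oddIdx deg i)) a)
    refine ⟨b, ?_⟩
    rw [oddProd_cons, ← mul_assoc, oddVar_eq, mul_smul_comm, const_mul_var, smul_mul_assoc,
      mul_assoc, hb, smul_mul_assoc, smul_mul_assoc, mul_assoc]

lemma const_mul_evenProd (l : List (Fin N)) (a : A) :
    ∃ b, const A _ a * evenProd A π deg l = evenProd A π deg l * const A _ b := by
  induction l generalizing a with
  | nil => exact ⟨a, by simp⟩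
  | cons i l ih =>
    obtain ⟨b, hb⟩ := ih (twist A (koszulDeg deg π (evenIdx deg i)) a)
    refine ⟨b, ?_⟩
    rw [evenProd_cons, ← mul_assoc, evenVar_eq, const_mul_var, mul_assoc, hb, mul_assoc]

/-- The additive span of the monomials is stable under left multiplication by constants and
variables, hence a left ideal; as it contains 1, it is everything. -/
lemma mul_closure_monomials (p : KoszulSpace A deg π) {q : KoszulSpace A deg π}
    (hq : q ∈ AddSubgroup.closure (monomials A deg π)) :
    p * q ∈ AddSubgroup.closure (monomials A deg π) := by
  have key : ∀ p : KoszulSpace A deg π, (∀ q ∈ monomials A deg π,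
      p * q ∈ AddSubgroup.closure (monomials A deg π)) →
      ∀ q ∈ AddSubgroup.closure (monomials A deg π),
        p * q ∈ AddSubgroup.closure (monomials A deg π) := by
    intro p hp q hq
    induction hq using AddSubgroup.closure_induction with
    | mem q hq => exact hp q hq
    | zero => rw [mul_zero]; exact zero_mem _
    | add x y _ _ hx hy => rw [mul_add]; exact add_mem hx hy
    | neg x _ hx => rw [mul_neg]; exact neg_mem hx
  have hodd : ∀ i, ∀ q ∈ AddSubgroup.closure (monomials A deg π),
      oddVar A deg π i * q ∈ AddSubgroup.closure (monomials A deg π) := by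
    intro i
    refine key _ ?_
    rintro _ ⟨l, l', a, rfl⟩
    refine AddSubgroup.subset_closure ⟨i :: l, l', a, ?_⟩
    simp only [oddProd_cons, mul_assoc]
  have heven : ∀ i, ∀ q ∈ AddSubgroup.closure (monomials A deg π),
      evenVar A deg π i * q ∈ AddSubgroup.closure (monomials A deg π) := by
    intro i
    refine key _ ?_
    rintro _ ⟨l, l', a, rfl⟩
    -- The new x must pass all the ξ's to reach normal form; the resulting sign does not matter for
    -- membership in a subgroup.
    have h := (evenVar_mul_oddProd (A := A) (deg := deg) (π := π) i l).mul_right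
      (evenProd A π deg l' * const A _ a)
    rw [← mul_assoc, ← mul_assoc] at *
    simp only [mul_assoc] at *
    refine h.mem (AddSubgroup.subset_closure ⟨l, i :: l', a, ?_⟩)
    simp only [evenProd_cons, mul_assoc]
  induction p using GradedPoly.induction generalizing q with
  | hc a =>
    refine key _ ?_ q hq
    rintro _ ⟨l, l', c, rfl⟩
    obtain ⟨b, hb⟩ := const_mul_oddProd (A := A) (deg := deg) (π := π) l a
    obtain ⟨b', hb'⟩ := const_mul_evenProd (A := A) (deg := deg) (π := π) l' b
    refine AddSubgroup.subset_closure ⟨l, l', b' * c, ?_⟩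
    rw [← mul_assoc, ← mul_assoc, hb, mul_assoc (oddProd A π deg l), hb', map_mul]
    simp only [mul_assoc]
  | hv s =>
    have hs : ∃ i, s = oddIdx deg i ∨ s = evenIdx deg i := by
      rcases s with i | i <;> refine ⟨i, ?_⟩ <;> unfold oddIdx evenIdx <;> split_ifs <;> simp
    obtain ⟨i, rfl | rfl⟩ := hs
    · have h := hodd i q hq
      rw [oddVar_eq, smul_mul_assoc] at h
      have h2 := zsmul_mem h (oddSign deg π i)
      rwa [smul_smul, oddSign_mul_self, one_smul] at h2
    · have h := heven i q hq
      rwa [evenVar_eq] at h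
  | hadd x y hx hy => rw [add_mul]; exact add_mem (hx hq) (hy hq)
  | hmul x y hx hy => rw [mul_assoc]; exact hx (hy hq)

lemma mem_closure_monomials (p : KoszulSpace A deg π) :
    p ∈ AddSubgroup.closure (monomials A deg π) := by
  have h := mul_closure_monomials p (q := 1)
    (AddSubgroup.subset_closure ⟨[], [], 1, by simp⟩)
  rwa [mul_one] at h

end Variables

/-! ### The homotopy between N plus the Euler operator and zero -/

section Homotopy

variable {N : ℕ} (A : GradedCommAlg.{u} K n) (deg : Fin N → Deg n) (π : Deg n)

/-- The signed Euler operator: the number of even variables minus the number of odd variables. -/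
noncomputable def euler : KoszulSpace A deg π →ₗ[K] KoszulSpace A deg π :=
  ∑ s, sgn (form (koszulDeg deg π s) (koszulDeg deg π s)) • numOp A (koszulDeg deg π) s

/-- The homotopy operator `∑ᵢ ∂/∂εⁱ ∂/∂Πeᵢ`. -/
noncomputable def homotopy : KoszulSpace A deg π →ₗ[K] KoszulSpace A deg π :=
  ∑ i, (pderiv A (koszulDeg deg π) (Sum.inr i)).comp (pderiv A (koszulDeg deg π) (Sum.inl i))

variable {A deg π}

lemma euler_apply (p : KoszulSpace A deg π) : euler A deg π p =
    ∑ s, sgn (form (koszulDeg deg π s) (koszulDeg deg π s)) •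
      numOp A (koszulDeg deg π) s p := by
  simp [euler, LinearMap.sum_apply, -zsmul_eq_mul]

lemma euler_mul (p q : KoszulSpace A deg π) :
    euler A deg π (p * q) = euler A deg π p * q + p * euler A deg π q := by
  simp only [euler_apply, numOp_mul, smul_add, Finset.sum_add_distrib, Finset.sum_mul,
    Finset.mul_sum, smul_mul_assoc, mul_smul_comm]

lemma euler_const (a : A) : euler A deg π (const A _ a) = 0 := by
  simp [euler_apply, numOp_apply]

lemma euler_var (t : Fin N ⊕ Fin N) : euler A deg π (var A _ t) =
    sgn (form (koszulDeg deg π t) (koszulDeg deg π t)) • var A _ t := by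
  rw [euler_apply, Finset.sum_eq_single t]
  · rw [numOp_var, if_pos rfl]
  · intro s _ h
    rw [numOp_var, if_neg h.symm, smul_zero]
  · simp

lemma euler_oddProd (hπ : IsOdd π) (l : List (Fin N)) :
    euler A deg π (oddProd A π deg l) = -((l.length : K) • oddProd A π deg l) := by
  induction l with
  | nil =>
    have h := euler_const (A := A) (deg := deg) (π := π) 1
    rw [map_one] at h
    simp [h]
  | cons i l ih =>
    rw [oddProd_cons, euler_mul, ih, oddVar_eq, map_zsmul, euler_var, form_oddIdx hπ,
      show sgn 1 = -1 from rfl, neg_one_smul, List.length_cons, Nat.cast_succ, add_smul, one_smul,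
      smul_neg, neg_mul, mul_neg, mul_smul_comm, neg_add, add_comm]

lemma euler_evenProd (hπ : IsOdd π) (l : List (Fin N)) :
    euler A deg π (evenProd A π deg l) = (l.length : K) • evenProd A π deg l := by
  induction l with
  | nil =>
    have h := euler_const (A := A) (deg := deg) (π := π) 1
    rw [map_one] at h
    simp [h]
  | cons i l ih =>
    rw [evenProd_cons, euler_mul, ih, evenVar_eq, euler_var, form_evenIdx hπ, sgn_zero, one_smul,
      List.length_cons, Nat.cast_succ, add_smul, one_smul, mul_smul_comm, add_comm]

/-- Both Πeⱼεʲ and the double derivative carry the odd degree π, so for distinct indices they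
anticommute: the exponents of the four exchanges add up to ⟨π, π⟩ = 1. -/
lemma pderiv_pderiv_mul_of_ne (hπ : IsOdd π) {i j : Fin N} (h : j ≠ i)
    (p : KoszulSpace A deg π) :
    pderiv A _ (Sum.inr i) (pderiv A _ (Sum.inl i)
      (parityVar A deg π j * dualVar A deg π j * p)) =
    -(parityVar A deg π j * dualVar A deg π j *
      pderiv A _ (Sum.inr i) (pderiv A _ (Sum.inl i) p)) := by
  rw [mul_assoc, pderiv_var_mul_of_ne (by simpa using h), pderiv_var_mul_of_ne (by simp),
    mul_smul_comm, smul_smul, map_zsmul, pderiv_var_mul_of_ne (by simp),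
    pderiv_var_mul_of_ne (by simpa using h), mul_smul_comm, smul_smul, smul_smul, mul_assoc,
    ← neg_one_smul ℤ]
  congr 1
  swap
  · exact (mul_assoc _ _ _).symm
  simp only [koszulDeg, Sum.elim_inl, Sum.elim_inr, ← sgn_add, form_add_left, form_add_right,
    show form π π = 1 from hπ]
  generalize form (deg i) (deg j) = a
  generalize form (deg i) π = b
  generalize form π (deg j) = c
  revert a b c
  decide

/-- The one-variable-pair case of the homotopy formula. Since Πeᵢ and εⁱ have opposite parities, the
terms containing both derivatives cancel, leaving 1 and the two signed number operators. -/
lemma pderiv_pderiv_mul_self (hπ : IsOdd π) (i : Fin N) (p : KoszulSpace A deg π) :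
    parityVar A deg π i * dualVar A deg π i *
      pderiv A _ (Sum.inr i) (pderiv A _ (Sum.inl i) p) +
    pderiv A _ (Sum.inr i) (pderiv A _ (Sum.inl i)
      (parityVar A deg π i * dualVar A deg π i * p)) =
    p + (sgn (form (koszulDeg deg π (Sum.inl i)) (koszulDeg deg π (Sum.inl i))) •
        numOp A _ (Sum.inl i) p +
      sgn (form (koszulDeg deg π (Sum.inr i)) (koszulDeg deg π (Sum.inr i))) •
        numOp A _ (Sum.inr i) p) := by
  have hs : sgn (form (koszulDeg deg π (Sum.inl i)) (koszulDeg deg π (Sum.inl i))) *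
      sgn (form (koszulDeg deg π (Sum.inr i)) (koszulDeg deg π (Sum.inr i))) = -1 := by
    simp only [koszulDeg, Sum.elim_inl, Sum.elim_inr, ← sgn_add, form_add_left, form_add_right,
      show form π π = 1 from hπ, form_comm π]
    generalize form (deg i) (deg i) = a
    generalize form (deg i) π = b
    revert a b
    decide
  rw [mul_assoc, mul_assoc, pderiv_var_mul_self, pderiv_var_mul_of_ne (by simp), map_add,
    pderiv_var_mul_self, mul_smul_comm, smul_smul, map_zsmul, pderiv_var_mul_of_ne (by simp),
    pderiv_var_mul_self, smul_smul, mul_add, mul_smul_comm, smul_add, smul_smul, mul_assoc,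
    form_comm (koszulDeg deg π (Sum.inr i)) (koszulDeg deg π (Sum.inl i)), sgn_mul_self,
    mul_one, hs, neg_one_smul, numOp_apply, numOp_apply]
  abel

/-- Mixed terms i ≠ j cancel in the anticommutator, and each of the N diagonal terms contributes one
copy of p and its part of the Euler operator. -/
lemma homotopy_formula (hπ : IsOdd π) (p : KoszulSpace A deg π) :
    dElem A deg π * homotopy A deg π p + homotopy A deg π (dElem A deg π * p) =
      (N : K) • p + euler A deg π p := by
  have h1 : dElem A deg π * homotopy A deg π p = ∑ i, ∑ j,
      parityVar A deg π j * dualVar A deg π j *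
        pderiv A _ (Sum.inr i) (pderiv A _ (Sum.inl i) p) := by
    simp only [dElem, homotopy, LinearMap.sum_apply, LinearMap.comp_apply, Finset.sum_mul_sum]
    exact Finset.sum_comm
  have h2 : homotopy A deg π (dElem A deg π * p) = ∑ i, ∑ j,
      pderiv A _ (Sum.inr i) (pderiv A _ (Sum.inl i)
        (parityVar A deg π j * dualVar A deg π j * p)) := by
    simp only [dElem, homotopy, LinearMap.sum_apply, LinearMap.comp_apply, Finset.sum_mul,
      map_sum]
    exact Finset.sum_comm
  have h3 : ∀ i, (∑ j, (parityVar A deg π j * dualVar A deg π j *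
        pderiv A _ (Sum.inr i) (pderiv A _ (Sum.inl i) p) +
      pderiv A _ (Sum.inr i) (pderiv A _ (Sum.inl i)
        (parityVar A deg π j * dualVar A deg π j * p)))) =
      p + (sgn (form (koszulDeg deg π (Sum.inl i)) (koszulDeg deg π (Sum.inl i))) •
        numOp A _ (Sum.inl i) p +
      sgn (form (koszulDeg deg π (Sum.inr i)) (koszulDeg deg π (Sum.inr i))) •
        numOp A _ (Sum.inr i) p) := by
    intro i
    rw [Finset.sum_eq_single i, pderiv_pderiv_mul_self hπ]
    · intro j _ h
      rw [pderiv_pderiv_mul_of_ne hπ h, add_neg_cancel]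
    · simp
  rw [h1, h2, ← Finset.sum_add_distrib]
  simp only [← Finset.sum_add_distrib, h3]
  rw [Finset.sum_add_distrib, Finset.sum_const, Finset.card_univ, Fintype.card_fin, euler_apply,
    Fintype.sum_sum_type, Finset.sum_add_distrib, Nat.cast_smul_eq_nsmul]

end Homotopy

/-! ### Reduction of cocycles to multiples of the top product -/

section Exactness

variable {N : ℕ} (A : GradedCommAlg.{u} K n) (deg : Fin N → Deg n) (π : Deg n)

/-- The operator `N + euler`, homotopic to zero. -/
noncomputable def shiftedEuler : Module.End K (KoszulSpace A deg π) :=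
  (N : K) • LinearMap.id + euler A deg π

variable {A deg π}

lemma shiftedEuler_apply (p : KoszulSpace A deg π) :
    shiftedEuler A deg π p = (N : K) • p + euler A deg π p := rfl

/-- The summands Πeᵢεⁱ all have odd degree π and hence anticommute, so the square of their sum is
its own negative. -/
lemma dElem_mul_dElem_mul [CharZero K] (hπ : IsOdd π) (p : KoszulSpace A deg π) :
    dElem A deg π * (dElem A deg π * p) = 0 := by
  have hsgn : sgn (form π π) = -1 := by rw [show form π π = 1 from hπ]; rfl
  have h1 : ∀ i j, parityVar A deg π i * dualVar A deg π i *
      (parityVar A deg π j * dualVar A deg π j) =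
      -(parityVar A deg π j * dualVar A deg π j *
        (parityVar A deg π i * dualVar A deg π i)) := by
    intro i j
    have hb : ∀ s t, GComm (koszulDeg deg π s) (koszulDeg deg π t)
      (var A (koszulDeg deg π) s) (var A (koszulDeg deg π) t) := var_mul_var
    have h2 : ∀ t, GComm π (koszulDeg deg π t) (parityVar A deg π i * dualVar A deg π i)
        (var A (koszulDeg deg π) t) := by
      intro t
      have h := (hb (Sum.inl i) t).mul (hb (Sum.inr i) t)
      simp only [koszulDeg, Sum.elim_inl, Sum.elim_inr] at h
      rwa [add_right_comm, deg_add_self, zero_add] at h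
    have h3 := (h2 (Sum.inl j)).symm.mul (h2 (Sum.inr j)).symm
    simp only [koszulDeg, Sum.elim_inl, Sum.elim_inr] at h3
    rw [add_right_comm, deg_add_self, zero_add] at h3
    have h4 := h3.symm
    unfold GComm at h4
    rw [hsgn, neg_one_smul] at h4
    exact h4
  have h2 : dElem A deg π * dElem A deg π = -(dElem A deg π * dElem A deg π) := by
    have h3 : dElem A deg π * dElem A deg π = ∑ i, ∑ j, parityVar A deg π i * dualVar A deg π i *
        (parityVar A deg π j * dualVar A deg π j) := Finset.sum_mul_sum _ _ _ _
    rw [h3]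
    nth_rewrite 1 [Finset.sum_comm]
    rw [← Finset.sum_neg_distrib]
    refine Finset.sum_congr rfl fun i _ => ?_
    rw [← Finset.sum_neg_distrib]
    exact Finset.sum_congr rfl fun j _ => h1 j i
  have h3 : (2 : K) • (dElem A deg π * dElem A deg π) = 0 := by
    rw [two_smul]
    nth_rewrite 1 [h2]
    exact neg_add_cancel _
  rw [← mul_assoc, (smul_eq_zero.mp h3).resolve_left two_ne_zero, zero_mul]

/-- The eigenvalue is N + #x − #ξ. It can vanish only if there are at least N factors ξ, which
leaves zero or the top product with no x. -/
lemma shiftedEuler_monomial (hπ : IsOdd π) (l l' : List (Fin N)) (a : A) :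
    shiftedEuler A deg π (oddProd A π deg l * evenProd A π deg l' * const A _ a) =
      ((N : K) + l'.length - l.length) •
        (oddProd A π deg l * evenProd A π deg l' * const A _ a) := by
  rw [shiftedEuler_apply, euler_mul, euler_const, mul_zero, add_zero, euler_mul,
    euler_oddProd hπ, euler_evenProd hπ, neg_mul, smul_mul_assoc, mul_smul_comm, add_mul, neg_mul,
    smul_mul_assoc, smul_mul_assoc]
  module

/-- With the operator written as Dh + hD and D² = 0, both sides equal DhDp. -/
lemma shiftedEuler_dElem_mul [CharZero K] (hπ : IsOdd π) (p : KoszulSpace A deg π) :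
    shiftedEuler A deg π (dElem A deg π * p) = dElem A deg π * shiftedEuler A deg π p := by
  rw [shiftedEuler_apply, shiftedEuler_apply, ← homotopy_formula hπ, ← homotopy_formula hπ,
    mul_add, dElem_mul_dElem_mul hπ, dElem_mul_dElem_mul hπ, map_zero, zero_add, add_zero]

open Polynomial in
/-- A cocycle killed by a polynomial in the shifted Euler operator with nonzero constant
coefficient is a coboundary. -/
lemma exists_eq_dElem_mul [CharZero K] (hπ : IsOdd π) {z : KoszulSpace A deg π} (q : K[X])
    (hq : q.eval 0 ≠ 0) (hz : aeval (shiftedEuler A deg π) q z = 0)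
    (hd : dElem A deg π * z = 0) : ∃ p, z = dElem A deg π * p := by
  have hcomm : ∀ (r : K[X]) (p : KoszulSpace A deg π),
      aeval (shiftedEuler A deg π) r (dElem A deg π * p) =
        dElem A deg π * aeval (shiftedEuler A deg π) r p := by
    intro r p
    induction r using Polynomial.induction_on' with
    | add r r' h h' => simp only [map_add, LinearMap.add_apply, h, h', mul_add]
    | monomial k c =>
      rw [aeval_monomial, Module.End.mul_apply, Module.End.mul_apply,
        Module.algebraMap_end_apply, Module.algebraMap_end_apply, mul_smul_comm]
      congr 1
      induction k with
      | zero => simp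
      | succ k ih =>
        rw [pow_succ', Module.End.mul_apply, ih, Module.End.mul_apply,
          shiftedEuler_dElem_mul hπ]
  have hE : shiftedEuler A deg π z = dElem A deg π * homotopy A deg π z := by
    rw [shiftedEuler_apply, ← homotopy_formula hπ, hd, map_zero, add_zero]
  -- On the cocycle z the operator E acts as z ↦ Dhz. Splitting q = q̃X + q(0) turns q(E)z = 0 into
  -- D(q̃(E)hz) + q(0)z = 0, which is solved for z.
  have hq2 := divX_mul_X_add q
  rw [← hq2, map_add, map_mul, aeval_X, LinearMap.add_apply, Module.End.mul_apply, hE, hcomm,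
    aeval_C, Module.algebraMap_end_apply, coeff_zero_eq_eval_zero] at hz
  refine ⟨-((q.eval 0)⁻¹ • aeval (shiftedEuler A deg π) q.divX (homotopy A deg π z)), ?_⟩
  rw [mul_neg, mul_smul_comm, eq_neg_of_add_eq_zero_left hz, smul_neg, neg_neg, smul_smul,
    inv_mul_cancel₀ hq, one_smul]

-- This replaces a decomposition into eigenvectors: after removal of a multiple of the top product,
-- z is annihilated by a product of factors X − λ with λ ≠ 0. Such a q is the input of
-- `exists_eq_dElem_mul`.
open Polynomial in
lemma exists_polynomial [CharZero K] (hπ : IsOdd π) (z : KoszulSpace A deg π) :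
    ∃ (a : A) (q : K[X]), q.eval 0 ≠ 0 ∧
      aeval (shiftedEuler A deg π) q (z - topElem A deg π * const A _ a) = 0 := by
  have hz := mem_closure_monomials z
  induction hz using AddSubgroup.closure_induction with
  | mem z hz =>
    obtain ⟨l, l', a, rfl⟩ := hz
    -- Eigenvalue zero gives #ξ = N + #x ≥ N, so the monomial vanishes or has #ξ = N and no x;
    -- otherwise X − λ is the required polynomial.
    by_cases hc : (N : K) + l'.length - l.length = 0
    · have hc' : N + l'.length = l.length := by
        have h := sub_eq_zero.mp hc
        exact_mod_cast h
      have hb : ∃ b, oddProd A π deg l * evenProd A π deg l' * const A _ a =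
          topElem A deg π * const A _ b := by
        rcases oddProd_of_length (A := A) (deg := deg) hπ (l := l) (by omega) with h | ⟨h, h' | h'⟩
        · exact ⟨0, by simp [h]⟩
        · obtain rfl : l' = [] := List.length_eq_zero_iff.mp (by omega)
          exact ⟨a, by rw [h', evenProd_nil, mul_one]⟩
        · obtain rfl : l' = [] := List.length_eq_zero_iff.mp (by omega)
          exact ⟨-a, by rw [h', evenProd_nil, mul_one, map_neg, neg_mul, mul_neg]⟩
      obtain ⟨b, hb⟩ := hb
      exact ⟨b, 1, by simp, by simp [hb]⟩
    · refine ⟨0, X - C ((N : K) + l'.length - l.length), ?_, ?_⟩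
      · rwa [eval_sub, eval_X, eval_C, zero_sub, neg_ne_zero]
      rw [map_zero, mul_zero, sub_zero, map_sub, aeval_X, aeval_C, LinearMap.sub_apply,
        shiftedEuler_monomial hπ, Module.algebraMap_end_apply, sub_self]
  | zero => exact ⟨0, 1, by simp, by simp⟩
  | add x y _ _ hx hy =>
    obtain ⟨a, q, hq, h⟩ := hx
    obtain ⟨b, r, hr, h'⟩ := hy
    -- Polynomials in one operator commute, so the product annihilates both summands.
    refine ⟨a + b, q * r, by simp [hq, hr], ?_⟩
    rw [map_add, mul_add, add_sub_add_comm, map_add, mul_comm q r, map_mul, Module.End.mul_apply,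
      h, map_zero, zero_add, ← map_mul, mul_comm r q, map_mul, Module.End.mul_apply, h', map_zero]
  | neg x _ hx =>
    obtain ⟨a, q, hq, h⟩ := hx
    refine ⟨-a, q, hq, ?_⟩
    rw [map_neg, mul_neg, neg_sub_neg, ← neg_sub, map_neg, h, neg_zero]

lemma oddVar_mul_topElem [CharZero K] (hπ : IsOdd π) (i : Fin N) :
    oddVar A deg π i * topElem A deg π = 0 := by
  rw [topElem_eq]
  exact oddVar_mul_oddProd_of_mem hπ (List.mem_finRange i)

lemma dElem_mul_topElem [CharZero K] (hπ : IsOdd π) :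
    dElem A deg π * topElem A deg π = 0 := by
  rw [dElem_eq, Finset.sum_mul]
  refine Finset.sum_eq_zero fun i _ => ?_
  rw [((evenVar_mul_oddVar i i).symm.mul_right _).eq_zero]
  rw [mul_assoc, oddVar_mul_topElem hπ, mul_zero]

/-- Every cocycle is cohomologous to a multiple of the top product. -/
lemma exists_of_dElem_mul_eq_zero [CharZero K] (hπ : IsOdd π) {z : KoszulSpace A deg π}
    (hz : dElem A deg π * z = 0) :
    ∃ a p, z = topElem A deg π * const A _ a + dElem A deg π * p := by
  obtain ⟨a, q, hq, h⟩ := exists_polynomial hπ z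
  obtain ⟨p, hp⟩ := exists_eq_dElem_mul hπ q hq h (by
    rw [mul_sub, hz, ← mul_assoc, dElem_mul_topElem hπ, zero_mul, sub_zero])
  exact ⟨a, p, by rw [← hp]; abel⟩

lemma oddProd_mul_evenProd_mem (l l' : List (Fin N)) (a : A) :
    oddProd A π deg l * evenProd A π deg l' * const A _ a ∈ cochains A deg π l.length :=
  Submodule.smul_mem _ (MulOpposite.op a) (Submodule.subset_span ⟨l, l', rfl, rfl⟩)

lemma topElem_mem_cocycles [CharZero K] (hπ : IsOdd π) :
    topElem A deg π ∈ cocycles A deg π N := by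
  refine ⟨?_, dElem_mul_topElem hπ⟩
  have h := oddProd_mul_evenProd_mem (A := A) (deg := deg) (π := π) (List.finRange N) [] 1
  rwa [List.length_finRange, evenProd_nil, mul_one, map_one, mul_one, ← topElem_eq] at h

/-- Every `N`-cochain is a multiple of the top product up to a coboundary. -/
lemma exists_of_mem_cochains [CharZero K] (hπ : IsOdd π) {z : KoszulSpace A deg π}
    (hz : z ∈ cochains A deg π N) :
    ∃ a, z - topElem A deg π * const A _ a ∈ coboundaries A deg π N := by
  -- If some xᵢ occurs, write ξ₁⋯ξ_N = ±ξᵢP with P the product of the other ξ's. Every ξⱼ with j ≠ i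
  -- kills P, so DP = ξᵢxᵢP, and the monomial is ±D applied to P times the remaining x's.
  have key : ∀ l', ∃ a, topElem A deg π * evenProd A π deg l' - topElem A deg π * const A _ a ∈
      coboundaries A deg π N := by
    intro l'
    rcases l' with _ | ⟨i, l'⟩
    · exact ⟨1, by simp⟩
    · refine ⟨0, ?_⟩
      rw [map_zero, mul_zero, sub_zero]
      set P := oddProd A π deg ((List.finRange N).erase i) with hP
      have h1 : SignEq (topElem A deg π) (oddVar A deg π i * P) := by
        rw [topElem_eq, ← oddProd_cons]
        exact oddProd_perm (List.perm_cons_erase (List.mem_finRange i))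
      have h2 : dElem A deg π * P = oddVar A deg π i * evenVar A deg π i * P := by
        rw [dElem_eq, Finset.sum_mul]
        refine Finset.sum_eq_single i (fun j _ hj => ?_) (by simp)
        refine ((evenVar_mul_oddVar j j).symm.mul_right _).eq_zero ?_
        rw [mul_assoc, oddVar_mul_oddProd_of_mem hπ, mul_zero]
        exact (List.mem_erase_of_ne hj).mpr (List.mem_finRange j)
      have h3 : SignEq (topElem A deg π * evenProd A π deg (i :: l'))
          (dElem A deg π * (P * evenProd A π deg l')) := by
        rw [← mul_assoc, h2, evenProd_cons, ← mul_assoc]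
        refine SignEq.mul_right ((h1.mul_right _).trans ?_) _
        rw [mul_assoc, mul_assoc]
        exact (evenVar_mul_oddProd i _).symm.mul_left _
      refine h3.mem ?_
      -- The existence of i forces N > 0, so the coboundaries are images of (N − 1)-cochains, and P
      -- has exactly N − 1 factors.
      obtain ⟨m, rfl⟩ : ∃ m, N = m + 1 := ⟨N - 1, by have := i.pos; omega⟩
      refine Submodule.mem_map.mpr ⟨P * evenProd A π deg l', ?_, rfl⟩
      have h := oddProd_mul_evenProd_mem (A := A) (deg := deg) (π := π)
        ((List.finRange (m + 1)).erase i) l' 1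
      rwa [List.length_erase_of_mem (List.mem_finRange i), List.length_finRange, map_one,
        mul_one] at h
  induction hz using Submodule.span_induction with
  | mem z hz =>
    obtain ⟨l, l', hl, rfl⟩ := hz
    change ∃ a, oddProd A π deg l * evenProd A π deg l' - _ ∈ _
    obtain ⟨a, ha⟩ := key l'
    rcases oddProd_of_length (A := A) (deg := deg) hπ (l := l) hl.ge with h | ⟨-, h | h⟩
    · exact ⟨0, by simp [h]⟩
    · exact ⟨a, by rwa [h]⟩
    · refine ⟨-a, ?_⟩
      rw [h, map_neg, mul_neg, neg_mul, neg_sub_neg, ← neg_sub]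
      exact neg_mem ha
  | zero => exact ⟨0, by simp⟩
  | add x y _ _ hx hy =>
    obtain ⟨a, ha⟩ := hx
    obtain ⟨b, hb⟩ := hy
    refine ⟨a + b, ?_⟩
    rw [map_add, mul_add, add_sub_add_comm]
    exact add_mem ha hb
  | smul c x _ hx =>
    obtain ⟨a, ha⟩ := hx
    refine ⟨a * c.unop, ?_⟩
    have h := Submodule.smul_mem _ c ha
    change (_ - _) * const A _ c.unop ∈ _ at h
    rw [sub_mul, mul_assoc, ← map_mul] at h
    exact h

end Exactness

/-! ### The top coefficient functional -/

section Residue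

variable {N : ℕ} (A : GradedCommAlg.{u} K n) (deg : Fin N → Deg n) (π : Deg n)

/-- The iterated derivative with respect to the odd variables in a list, evaluated at zero. -/
noncomputable def coeffOdd : List (Fin N) → KoszulSpace A deg π →ₗ[K] A
  | [] => (evalZero A _).toLinearMap
  | i :: l => (coeffOdd l).comp (oddSign deg π i • pderiv A _ (oddIdx deg i))

/-- The coefficient of the top product at the origin. -/
noncomputable def topCoeff : KoszulSpace A deg π →ₗ[K] A := coeffOdd A deg π (List.finRange N)

variable {A deg π}

lemma coeffOdd_nil (p : KoszulSpace A deg π) : coeffOdd A deg π [] p = evalZero A _ p := rfl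

lemma coeffOdd_cons (i : Fin N) (l : List (Fin N)) (p : KoszulSpace A deg π) :
    coeffOdd A deg π (i :: l) p =
      coeffOdd A deg π l (oddSign deg π i • pderiv A _ (oddIdx deg i) p) := rfl

lemma coeffOdd_mul_const (l : List (Fin N)) (p : KoszulSpace A deg π) (a : A) :
    coeffOdd A deg π l (p * const A _ a) = coeffOdd A deg π l p * a := by
  induction l generalizing p with
  | nil => rw [coeffOdd_nil, map_mul, evalZero_const, coeffOdd_nil]
  | cons i l ih => rw [coeffOdd_cons, pderiv_mul_const, ← smul_mul_assoc, ih, coeffOdd_cons]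

/-- Derivatives in the ξ's pass xᵢ up to sign, and evaluation at zero then kills it. -/
lemma coeffOdd_evenVar_mul (l : List (Fin N)) (i : Fin N) (p : KoszulSpace A deg π) :
    coeffOdd A deg π l (evenVar A deg π i * p) = 0 := by
  rw [evenVar_eq]
  induction l generalizing p with
  | nil => rw [coeffOdd_nil, map_mul, evalZero_var, zero_mul]
  | cons j l ih =>
    rw [coeffOdd_cons, pderiv_var_mul_of_ne (evenIdx_ne_oddIdx i j), map_zsmul, map_zsmul, ih,
      smul_zero, smul_zero]

lemma pderiv_oddProd_of_notMem {i : Fin N} {l : List (Fin N)} (h : i ∉ l) :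
    pderiv A _ (oddIdx deg i) (oddProd A π deg l) = 0 := by
  induction l with
  | nil =>
    have h := pderiv_const (A := A) (δ := koszulDeg deg π) (oddIdx deg i) 1
    rwa [map_one] at h
  | cons j l ih =>
    rw [List.mem_cons, not_or] at h
    rw [oddProd_cons, oddVar_eq, smul_mul_assoc, map_zsmul,
      pderiv_var_mul_of_ne (fun he => h.1 (oddIdx_injective he).symm), ih h.2, mul_zero, smul_zero,
      smul_zero]

lemma coeffOdd_oddProd {l : List (Fin N)} (h : l.Nodup) :
    coeffOdd A deg π l (oddProd A π deg l) = 1 := by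
  induction l with
  | nil => rw [coeffOdd_nil, oddProd_nil, map_one]
  | cons i l ih =>
    rw [List.nodup_cons] at h
    rw [coeffOdd_cons, oddProd_cons, oddVar_eq, smul_mul_assoc, map_zsmul (pderiv _ _ _),
      pderiv_var_mul_self,
      pderiv_oddProd_of_notMem h.1, mul_zero, smul_zero, add_zero, smul_smul, oddSign_mul_self,
      one_smul, ih h.2]

lemma topCoeff_mul_const (p : KoszulSpace A deg π) (a : A) :
    topCoeff A deg π (p * const A _ a) = topCoeff A deg π p * a := coeffOdd_mul_const _ _ _

lemma topCoeff_topElem : topCoeff A deg π (topElem A deg π) = 1 := by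
  rw [topElem_eq]
  exact coeffOdd_oddProd (List.nodup_finRange N)

lemma topCoeff_topElem_mul_const (a : A) :
    topCoeff A deg π (topElem A deg π * const A _ a) = a := by
  rw [topCoeff_mul_const, topCoeff_topElem, one_mul]

/-- Each term ξᵢxᵢp is ±xᵢ(ξᵢp), so the functional descends to cohomology. -/
lemma topCoeff_dElem_mul (p : KoszulSpace A deg π) :
    topCoeff A deg π (dElem A deg π * p) = 0 := by
  rw [dElem_eq, Finset.sum_mul, map_sum]
  refine Finset.sum_eq_zero fun i _ => ?_
  have h := coeffOdd_evenVar_mul (List.finRange N) i (oddVar A deg π i * p)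
  rw [← mul_assoc] at h
  rcases (evenVar_mul_oddVar i i).symm.mul_right p with h' | h'
  · rw [h']; exact h
  · rw [h', map_neg, neg_eq_zero]; exact h

end Residue

/-! ### The cohomology is free of rank one -/

section CohomologyBasis

variable {N : ℕ} {A : GradedCommAlg.{u} K n} {deg : Fin N → Deg n} {π : Deg n}

/-- Apply the top coefficient to both sides. Here p is arbitrary, not a cochain of a given degree,
which is what injectivity of the map to the total cohomology needs. -/
lemma topElem_mul_const_injective {a : A} {p : KoszulSpace A deg π}
    (h : topElem A deg π * const A _ a = dElem A deg π * p) : a = 0 := by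
  rw [← topCoeff_topElem_mul_const (deg := deg) (π := π) a, h, topCoeff_dElem_mul]

lemma toTotal_bijective [CharZero K] (hπ : IsOdd π) :
    Function.Bijective (toTotal A deg π N) := by
  constructor
  · rw [injective_iff_map_eq_zero]
    intro c hc
    obtain ⟨⟨z, hz⟩, rfl⟩ := Submodule.Quotient.mk_surjective _ c
    obtain ⟨p, hp⟩ := (Submodule.Quotient.mk_eq_zero _).mp hc
    change dElem A deg π * p = z at hp
    obtain ⟨a, ha⟩ := exists_of_mem_cochains hπ hz.1
    obtain ⟨q, hq⟩ := coboundaries_le _ _ _ _ ha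
    change dElem A deg π * q = _ at hq
    -- The primitive p of z need not be an (N − 1)-cochain. But z differs from a top multiple by a
    -- genuine degree-N coboundary, and that top multiple is then exact in the total space, so its
    -- coefficient is zero.
    have h0 : a = 0 := topElem_mul_const_injective (p := p - q) (by
      rw [mul_sub, hp, hq, sub_sub_cancel])
    rw [h0, map_zero, mul_zero, sub_zero] at ha
    exact (Submodule.Quotient.mk_eq_zero _).mpr ha
  · intro c
    obtain ⟨⟨z, hz⟩, rfl⟩ := Submodule.Quotient.mk_surjective _ c
    obtain ⟨a, p, h⟩ := exists_of_dElem_mul_eq_zero hπ (z := z) hz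
    refine ⟨MulOpposite.op a • Submodule.Quotient.mk ⟨topElem A deg π, topElem_mem_cocycles hπ⟩, ?_⟩
    refine (Submodule.Quotient.eq _).mpr ⟨-p, ?_⟩
    change dElem A deg π * -p = topElem A deg π * const A _ a - z
    rw [h]
    simp

lemma topClass_bijective [CharZero K] (hπ : IsOdd π) :
    Function.Bijective fun a : A => MulOpposite.op a • (Submodule.Quotient.mk
      ⟨topElem A deg π, topElem_mem_cocycles hπ⟩ : Cohomology A deg π N) := by
  constructor
  · intro a b hab
    simp only [← Submodule.Quotient.mk_smul] at hab
    obtain ⟨p, hp⟩ := coboundaries_le _ _ _ _ ((Submodule.Quotient.eq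
      ((coboundaries A deg π N).submoduleOf (cocycles A deg π N))).mp hab)
    change dElem A deg π * p = topElem A deg π * const A _ a - topElem A deg π * const A _ b at hp
    rw [← mul_sub, ← map_sub] at hp
    exact sub_eq_zero.mp (topElem_mul_const_injective hp.symm)
  · intro c
    obtain ⟨⟨z, hz⟩, rfl⟩ := Submodule.Quotient.mk_surjective _ c
    obtain ⟨a, ha⟩ := exists_of_mem_cochains hπ hz.1
    refine ⟨a, (Submodule.Quotient.eq _).mpr ?_⟩
    rw [← neg_mem_iff, neg_sub]
    exact ha

end CohomologyBasis

/-! ### Change of the coefficient algebra -/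

section Naturality

variable {A B : GradedCommAlg.{u} K n} {f : A →ₐ[K] B}

lemma map_twist (hf : ∀ (γ : Deg n) (a : A), a ∈ A.grading γ → f a ∈ B.grading γ)
    (β : Deg n) (a : A) : f (twist A β a) = twist B β (f a) := by
  induction a using A.induction with
  | hom α a ha => rw [twist_of_mem ha, twist_of_mem (hf α a ha), map_zsmul]
  | add a b h h' => simp only [map_add, h, h']

variable {σ : Type} {δ : σ → Deg n}
  (hf : ∀ (γ : Deg n) (a : A), a ∈ A.grading γ → f a ∈ B.grading γ)

/-- The map of polynomial algebras induced by a degree-preserving map of coefficients. -/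
def polyMap (δ : σ → Deg n) : GradedPoly A δ →ₐ[K] GradedPoly B δ :=
  liftPoly ((const B δ).comp f) (var B δ)
    (fun s α a ha => var_mul_const s α (f a) (hf α a ha)) var_mul_var

@[simp] lemma polyMap_const (a : A) : polyMap hf δ (const A δ a) = const B δ (f a) :=
  liftPoly_const _ _ _ _ a

@[simp] lemma polyMap_var (s : σ) : polyMap hf δ (var A δ s) = var B δ s :=
  liftPoly_var _ _ _ _ s

lemma polyMap_polyTwist (β : Deg n) (p : GradedPoly A δ) :
    polyMap hf δ (polyTwist A δ β p) = polyTwist B δ β (polyMap hf δ p) := by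
  have h : (polyMap hf δ).comp (polyTwist A δ β) = (polyTwist B δ β).comp (polyMap hf δ) :=
    algHom_ext (fun a => by simp [map_twist hf]) (fun s => by simp [-zsmul_eq_mul])
  exact DFunLike.congr_fun h p

lemma evalZero_polyMap (p : GradedPoly A δ) :
    evalZero B δ (polyMap hf δ p) = f (evalZero A δ p) := by
  have h : (evalZero B δ).comp (polyMap hf δ) = f.comp (evalZero A δ) :=
    algHom_ext (by simp) (by simp)
  exact DFunLike.congr_fun h p

variable [DecidableEq σ]

lemma pderiv_polyMap (s : σ) (p : GradedPoly A δ) :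
    pderiv B δ s (polyMap hf δ p) = polyMap hf δ (pderiv A δ s p) := by
  induction p using GradedPoly.induction with
  | hc a => simp
  | hv t =>
    rw [polyMap_var, pderiv_var, pderiv_var]
    split_ifs <;> simp
  | hadd x y hx hy => simp only [map_add, hx, hy]
  | hmul x y hx hy =>
    rw [map_mul, pderiv_mul, pderiv_mul, hx, hy, map_add, map_mul, map_mul, polyMap_polyTwist]

lemma substHom_polyMap [Fintype σ] {X : degZeroMatrices A δ} {Y : degZeroMatrices B δ}
    (h : ∀ i j, Y.1 i j = f (X.1 i j)) (p : GradedPoly A δ) :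
    substHom Y (polyMap hf δ p) = polyMap hf δ (substHom X p) := by
  have h : (substHom Y).comp (polyMap hf δ) = (polyMap hf δ).comp (substHom X) :=
    algHom_ext (by simp) (by simp [h])
  exact DFunLike.congr_fun h p

variable (δ) in
/-- The map of groups `GL⁰` induced by a degree-preserving map of algebras. -/
def glMap [Fintype σ] : GLZero A δ →* GLZero B δ :=
  Units.map ((f.toRingHom.mapMatrix.restrict (degZeroMatrices A δ) (degZeroMatrices B δ)
    fun _ hX i j => hf _ _ (hX i j) :
      degZeroMatrices A δ →+* degZeroMatrices B δ) : degZeroMatrices A δ →* degZeroMatrices B δ)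

lemma eq_glMap [Fintype σ] {T : GLZero A δ} {T' : GLZero B δ}
    (h : ∀ i j, T'.val.1 i j = f (T.val.1 i j)) : T' = glMap δ hf T :=
  Units.ext (Subtype.ext (Matrix.ext h))

end Naturality

/-! ### Degree preservation and diagonal matrices -/

section DegreeZero

variable {σ : Type} {A : GradedCommAlg.{u} K n} {δ : σ → Deg n}

lemma const_comm_of_mem_zero {a : A} (ha : a ∈ A.grading 0) (p : GradedPoly A δ) :
    const A δ a * p = p * const A δ a := by
  induction p using GradedPoly.induction with
  | hc b => rw [← map_mul, zero_comm ha, map_mul]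
  | hv s => rw [const_mul_var, twist_of_mem ha, form_zero_right, sgn_zero, one_smul]
  | hadd x y hx hy => rw [mul_add, add_mul, hx, hy]
  | hmul x y hx hy => rw [← mul_assoc, hx, mul_assoc, hy, mul_assoc]

variable [Fintype σ] [DecidableEq σ]

/-- A matrix entry of degree δₛ + δₜ times the variable s has the degree of t, so the substitution
preserves degrees. -/
lemma substHom_polyTwist (X : degZeroMatrices A δ) (β : Deg n) (p : GradedPoly A δ) :
    substHom X (polyTwist A δ β p) = polyTwist A δ β (substHom X p) := by
  have h : (substHom X).comp (polyTwist A δ β) = (polyTwist A δ β).comp (substHom X) := by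
    refine algHom_ext (by simp) (fun t => ?_)
    simp only [AlgHom.comp_apply, polyTwist_var, map_zsmul, substHom_var, map_sum, map_mul,
      polyTwist_const, Finset.smul_sum]
    refine Finset.sum_congr rfl fun s _ => ?_
    rw [twist_of_mem (X.2 s t), map_zsmul, smul_mul_smul_comm, ← sgn_add, ← form_add_right,
      ← add_assoc, deg_add_self, zero_add]
  exact DFunLike.congr_fun h p

variable (A δ) in
/-- The diagonal matrices of degree zero. -/
def diagMatrix : (σ → A.grading 0) →* degZeroMatrices A δ where
  toFun w := ⟨Matrix.diagonal fun i => (w i : A), fun i j => by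
    by_cases h : i = j
    · subst h
      rw [Matrix.diagonal_apply_eq, deg_add_self]
      exact (w i).2
    · rw [Matrix.diagonal_apply_ne _ h]
      exact Submodule.zero_mem _⟩
  map_one' := Subtype.ext Matrix.diagonal_one
  map_mul' w w' := Subtype.ext (Matrix.diagonal_mul_diagonal _ _).symm

variable (A δ) in
/-- The invertible diagonal matrices of degree zero. -/
def diagUnits : (σ → (A.grading 0)ˣ) →* GLZero A δ :=
  (Units.map (diagMatrix A δ)).comp (MulEquiv.piUnits.symm : _ ≃* _).toMonoidHom

lemma diagUnits_apply (w : σ → (A.grading 0)ˣ) :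
    (diagUnits A δ w).val.1 = Matrix.diagonal fun i => ((w i).val : A) := rfl

end DegreeZero

/-! ### The scalar by which GL⁰ acts on the top class -/

section CohomologicalBerezinian

variable {N : ℕ} {A : GradedCommAlg.{u} K n} {deg : Fin N → Deg n} {π : Deg n}

lemma polyTwist_oddProd (β : Deg n) (l : List (Fin N)) :
    polyTwist A _ β (oddProd A π deg l) =
      sgn (l.map fun i => form β (koszulDeg deg π (oddIdx deg i))).sum • oddProd A π deg l := by
  induction l with
  | nil => simp [sgn]
  | cons i l ih =>
    rw [oddProd_cons, map_mul, ih, oddVar_eq, map_zsmul, polyTwist_var, List.map_cons,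
      List.sum_cons, sgn_add, smul_comm, smul_mul_smul_comm]

/-- Each derivative shifts the degree by that of its variable. The accumulated sign is the same as
in `polyTwist_oddProd`, so the two cancel in `topCoeff_action_mem`. -/
lemma coeffOdd_polyTwist (β : Deg n) (l : List (Fin N)) (p : KoszulSpace A deg π) :
    coeffOdd A deg π l (polyTwist A _ β p) =
      sgn (l.map fun i => form β (koszulDeg deg π (oddIdx deg i))).sum •
        twist A β (coeffOdd A deg π l p) := by
  induction l generalizing p with
  | nil => rw [coeffOdd_nil, polyTwist_evalZero, List.map_nil, List.sum_nil, sgn_zero, one_smul,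
      coeffOdd_nil]
  | cons i l ih =>
    rw [coeffOdd_cons, pderiv_polyTwist, smul_comm, map_zsmul, ← map_zsmul (polyTwist _ _ _), ih,
      smul_smul, ← sgn_add, List.map_cons, List.sum_cons, coeffOdd_cons]

/-- The top coefficient of `φ_T(ξ₁ ⋯ ξ_N)` has degree zero. -/
lemma topCoeff_action_mem [CharZero K] (T : GLZero A deg) :
    topCoeff A deg π (action π T (topElem A deg π)) ∈ A.grading 0 := by
  refine mem_zero_of_twist fun β => ?_
  have h : action π T (polyTwist A _ β (topElem A deg π)) =
      polyTwist A _ β (action π T (topElem A deg π)) := substHom_polyTwist _ β _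
  have h2 := coeffOdd_polyTwist β (List.finRange N) (action π T (topElem A deg π))
  rw [← h, topElem_eq, polyTwist_oddProd, map_zsmul, map_zsmul] at h2
  have h3 := congrArg (fun x =>
    sgn ((List.finRange N).map fun i => form β (koszulDeg deg π (oddIdx deg i))).sum • x) h2
  simp only [smul_smul, sgn_mul_self, one_smul] at h3
  rw [topElem_eq]
  exact h3.symm

/-- Modulo D, the cocycle p is the top product times its top coefficient, and φ_T is A-linear and
fixes D. Applied to φ_T(ξ₁⋯ξ_N), this gives multiplicativity of `cohBer`. -/
lemma topCoeff_action [CharZero K] (hπ : IsOdd π) (T : GLZero A deg)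
    (p : KoszulSpace A deg π) (hp : dElem A deg π * p = 0) :
    topCoeff A deg π (action π T p) =
      topCoeff A deg π (action π T (topElem A deg π)) * topCoeff A deg π p := by
  obtain ⟨a, q, rfl⟩ := exists_of_dElem_mul_eq_zero hπ hp
  rw [map_add, map_mul, map_mul, action_dElem, action_const, map_add, topCoeff_dElem_mul,
    add_zero, topCoeff_mul_const, map_add, topCoeff_dElem_mul, add_zero,
    topCoeff_topElem_mul_const]

variable (A deg) in
/-- The Berezinian defined through the action on cohomology. -/
noncomputable def cohBer [CharZero K] (hπ : IsOdd π) : GLZero A deg →* (A.grading 0)ˣ :=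
  MonoidHom.toHomUnits
    { toFun := fun T => ⟨topCoeff A deg π (action π T (topElem A deg π)), topCoeff_action_mem T⟩
      map_one' := Subtype.ext ((congrArg (fun φ : KoszulSpace A deg π →ₐ[K] KoszulSpace A deg π =>
        topCoeff A deg π (φ (topElem A deg π))) (map_one (action π))).trans topCoeff_topElem)
      map_mul' := fun S T => Subtype.ext (by
        refine (congrArg (fun φ : KoszulSpace A deg π →ₐ[K] KoszulSpace A deg π =>
          topCoeff A deg π (φ (topElem A deg π))) (map_mul (action π) S T)).trans ?_
        refine topCoeff_action hπ S _ ?_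
        have h := congrArg (action π T) (dElem_mul_topElem (A := A) (deg := deg) hπ)
        rw [map_mul, action_dElem, map_zero] at h
        exact h) }

lemma cohBer_apply [CharZero K] (hπ : IsOdd π) (T : GLZero A deg) :
    ((cohBer A deg hπ T).val : A) = topCoeff A deg π (action π T (topElem A deg π)) := rfl

lemma action_parityVar (T : GLZero A deg) (i : Fin N) : action π T (parityVar A deg π i) =
      ∑ j, parityVar A deg π j * const A _ (T.val.1 j i) := by
    refine (substHom_var _ _).trans ?_
    simp [actionMatrix, Fintype.sum_sum_type]

lemma action_dualVar (T : GLZero A deg) (i : Fin N) : action π T (dualVar A deg π i) =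
      ∑ k, dualVar A deg π k * const A _ ((gradedTranspose (T⁻¹).val).1 k i) := by
    refine (substHom_var _ _).trans ?_
    simp [actionMatrix, Fintype.sum_sum_type]

/-- For even γᵢ the variable ξᵢ comes from ΠM and is scaled by wᵢ; for odd γᵢ it comes from M*,
where the inverse matrix acts. This is the source of the inverse determinants in the Berezinian. -/
lemma action_diagUnits_oddVar (w : Fin N → (A.grading 0)ˣ) (i : Fin N) :
    action π (diagUnits A deg w) (oddVar A deg π i) = oddVar A deg π i *
      const A _ ((if IsEven (deg i) then w i else (w i)⁻¹ : (A.grading 0)ˣ).val : A) := by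
  by_cases h : IsEven (deg i)
  · rw [if_pos h, oddVar, if_pos h, action_parityVar, Finset.sum_eq_single i]
    · rw [diagUnits_apply, Matrix.diagonal_apply_eq]
    · intro j _ hj
      rw [diagUnits_apply, Matrix.diagonal_apply_ne _ hj, map_zero, mul_zero]
    · simp
  · rw [if_neg h, oddVar, if_neg h, map_neg, map_zsmul, action_dualVar, Finset.sum_eq_single i,
      ← map_inv]
    · have h0 : form (deg i + deg i) (deg i) = 0 := by rw [deg_add_self, form_zero_left]
      simp only [gradedTranspose, h0, sgn_zero, one_smul]
      rw [diagUnits_apply, Matrix.diagonal_apply_eq, neg_mul, smul_mul_assoc, Pi.inv_apply]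
    · intro j _ hj
      rw [← map_inv]
      simp only [gradedTranspose]
      rw [diagUnits_apply, Matrix.diagonal_apply_ne _ hj.symm, smul_zero, map_zero, mul_zero]
    · simp

lemma map_oddProd_of_scale {φ : KoszulSpace A deg π →ₐ[K] KoszulSpace A deg π}
    {c : Fin N → A.grading 0}
    (h : ∀ i, φ (oddVar A deg π i) = oddVar A deg π i * const A _ (c i : A))
    (l : List (Fin N)) :
    φ (oddProd A π deg l) = oddProd A π deg l * const A _ ((l.map c).prod : A.grading 0) := by
  induction l with
  | nil =>
    rw [oddProd_nil, map_one, List.map_nil, List.prod_nil, one_mul]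
    exact (map_one (const A _)).symm
  | cons i l ih =>
    rw [oddProd_cons, map_mul, ih, h, List.map_cons, List.prod_cons, mul_assoc,
      ← mul_assoc (const A _ _), const_comm_of_mem_zero (c i).2]
    have e : ((c i * (l.map c).prod : A.grading 0) : A) =
        (c i : A) * ((l.map c).prod : A.grading 0) := rfl
    rw [e, map_mul]
    simp only [mul_assoc]

lemma cohBer_diagUnits [CharZero K] (hπ : IsOdd π) (w : Fin N → (A.grading 0)ˣ) :
    cohBer A deg hπ (diagUnits A deg w) =
      ∏ i, if IsEven (deg i) then w i else (w i)⁻¹ := by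
  apply Units.ext
  apply Subtype.ext
  rw [cohBer_apply, topElem_eq, map_oddProd_of_scale (action_diagUnits_oddVar w), ← topElem_eq,
    topCoeff_topElem_mul_const, Fin.prod_univ_def]
  congr 1
  rw [← Units.coeHom_apply, map_list_prod, List.map_map]
  rfl

lemma coeffOdd_polyMap {B : GradedCommAlg.{u} K n} {f : A →ₐ[K] B}
    (hf : ∀ (γ : Deg n) (a : A), a ∈ A.grading γ → f a ∈ B.grading γ) (l : List (Fin N))
    (p : KoszulSpace A deg π) :
    coeffOdd B deg π l (polyMap hf _ p) = f (coeffOdd A deg π l p) := by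
  induction l generalizing p with
  | nil => exact evalZero_polyMap hf p
  | cons i l ih =>
    rw [coeffOdd_cons, pderiv_polyMap, ← map_zsmul, ih, coeffOdd_cons]

lemma polyMap_topElem {B : GradedCommAlg.{u} K n} {f : A →ₐ[K] B}
    (hf : ∀ (γ : Deg n) (a : A), a ∈ A.grading γ → f a ∈ B.grading γ) :
    polyMap hf _ (topElem A deg π) = topElem B deg π := by
  rw [topElem_eq, topElem_eq, oddProd, oddProd, map_list_prod, List.map_map]
  congr 2
  funext i
  rw [Function.comp_apply, oddVar_eq, oddVar_eq, map_zsmul, polyMap_var]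

lemma cohBer_natural [CharZero K] (hπ : IsOdd π) {B : GradedCommAlg.{u} K n} {f : A →ₐ[K] B}
    (hf : ∀ (γ : Deg n) (a : A), a ∈ A.grading γ → f a ∈ B.grading γ) (T : GLZero A deg) :
    ((cohBer B deg hπ (glMap deg hf T)).val : B) = f ((cohBer A deg hπ T).val : A) := by
  rw [cohBer_apply, cohBer_apply, topCoeff, topCoeff, ← coeffOdd_polyMap hf, ← polyMap_topElem hf]
  congr 1
  refine substHom_polyMap hf ?_ _
  have h : ∀ i j, (gradedTranspose ((glMap deg hf T)⁻¹).val).1 i j =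
      f ((gradedTranspose (T⁻¹).val).1 i j) := by
    intro i j
    rw [← map_inv]
    exact (map_zsmul f _ _).symm
  rintro (i | i) (j | j)
  · rfl
  · exact (map_zero f).symm
  · exact (map_zero f).symm
  · exact h i j

end CohomologicalBerezinian

/-! ### Elementary column matrices and generation of GL⁰ -/

section Generation

variable {σ : Type} [Fintype σ] [DecidableEq σ] {A : GradedCommAlg.{u} K n} {δ : σ → Deg n}

/-- The matrix that differs from the identity by a vector `v` added to the column `j`. -/
def colMatrix (j : σ) (v : σ → A) (hv : ∀ i, v i ∈ A.grading (δ i + δ j)) :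
    degZeroMatrices A δ :=
  ⟨fun i k => (1 : Matrix σ σ A) i k + if k = j then v i else 0, fun i k => by
    refine Submodule.add_mem _ ((1 : degZeroMatrices A δ).2 i k) ?_
    split_ifs with h
    · exact h ▸ hv i
    · exact Submodule.zero_mem _⟩

lemma colMatrix_mul_apply (j : σ) (v : σ → A) (hv : ∀ i, v i ∈ A.grading (δ i + δ j))
    (X : degZeroMatrices A δ) (i k : σ) :
    (colMatrix j v hv * X).1 i k = X.1 i k + v i * X.1 j k := by
  change ∑ m, ((1 : Matrix σ σ A) i m + if m = j then v i else 0) * X.1 m k = _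
  simp [add_mul, Finset.sum_add_distrib, Matrix.one_apply]

lemma mul_colMatrix_apply (j : σ) (v : σ → A) (hv : ∀ i, v i ∈ A.grading (δ i + δ j))
    (X : degZeroMatrices A δ) (i k : σ) :
    (X * colMatrix j v hv).1 i k = X.1 i k + if k = j then ∑ m, X.1 i m * v m else 0 := by
  change ∑ m, X.1 i m * ((1 : Matrix σ σ A) m k + if k = j then v m else 0) = _
  simp only [mul_add, Finset.sum_add_distrib, Matrix.one_apply, mul_ite, mul_one, mul_zero,
    Finset.sum_ite_eq', Finset.mem_univ, if_true]
  split_ifs <;> simp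

/-- The quadratic term of (1 + v eⱼᵗ)(1 + w eⱼᵗ) contains the scalar wⱼ, which is zero. -/
lemma colMatrix_mul_colMatrix {j : σ} {v w : σ → A} (hv : ∀ i, v i ∈ A.grading (δ i + δ j))
    (hw : ∀ i, w i ∈ A.grading (δ i + δ j)) (hwj : w j = 0) :
    colMatrix j v hv * colMatrix j w hw =
      colMatrix j (v + w) fun i => Submodule.add_mem _ (hv i) (hw i) := by
  apply Subtype.ext
  ext i k
  rw [colMatrix_mul_apply]
  simp only [colMatrix, Pi.add_apply]
  by_cases hk : k = j
  · subst hk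
    simp [hwj, add_assoc, add_comm]
  · simp [hk, Matrix.one_apply, Ne.symm hk]

/-- The invertible matrix that differs from the identity by the off-diagonal part of the
column `j`. -/
def colUnit (j : σ) (v : σ → A) (hv : ∀ i, v i ∈ A.grading (δ i + δ j)) (hj : v j = 0) :
    GLZero A δ where
  val := colMatrix j v hv
  inv := colMatrix j (-v) fun i => Submodule.neg_mem _ (hv i)
  val_inv := by
    rw [colMatrix_mul_colMatrix _ _ (by simp [hj])]
    apply Subtype.ext
    ext i k
    simp [colMatrix]
  inv_val := by
    rw [colMatrix_mul_colMatrix _ _ hj]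
    apply Subtype.ext
    ext i k
    simp [colMatrix]

variable (A) in
/-- The unit `2` of the degree-zero part. -/
def twoUnit [CharZero K] : (A.grading 0)ˣ :=
  Units.map (algebraMap K (A.grading 0) : K →* A.grading 0) (Units.mk0 2 two_ne_zero)

lemma coe_twoUnit [CharZero K] : ((twoUnit A).val : A) = 2 := map_ofNat (algebraMap K A) 2

/-- Homomorphisms to commutative groups are trivial on elementary column matrices, since these
are conjugate to their squares. -/
lemma map_colUnit [CharZero K] {G : Type*} [CommGroup G] (φ : GLZero A δ →* G) (j : σ)
    (v : σ → A) (hv : ∀ i, v i ∈ A.grading (δ i + δ j)) (hj : v j = 0) :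
    φ (colUnit j v hv hj) = 1 := by
  set C := colUnit j v hv hj with hC
  set D := diagUnits A δ (Pi.mulSingle j (twoUnit A)) with hD
  -- D has the entry 2 at position j and 1 elsewhere, so conjugation by it doubles v, and C with 2v
  -- is C². In a commutative target this gives φ(C) = φ(C)².
  have h : C * D = D * (C * C) := by
    apply Units.ext
    apply Subtype.ext
    have hC' : (C * C).val = colMatrix j (v + v) fun i => Submodule.add_mem _ (hv i) (hv i) :=
      colMatrix_mul_colMatrix hv hv hj
    rw [Units.val_mul, Units.val_mul, hC', Subring.coe_mul, Subring.coe_mul, hD, diagUnits_apply]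
    ext i k
    rw [Matrix.mul_diagonal, Matrix.diagonal_mul]
    change ((1 : Matrix σ σ A) i k + if k = j then v i else 0) * _ =
      _ * ((1 : Matrix σ σ A) i k + if k = j then v i + v i else 0)
    by_cases hk : k = j
    · subst hk
      by_cases hi : i = k
      · subst hi
        simp [hj]
      · simp [Pi.mulSingle_eq_of_ne hi, coe_twoUnit, Matrix.one_apply_ne hi, mul_two]
    · by_cases hi : i = k
      · subst hi
        simp [hk]
      · simp [hk, Matrix.one_apply_ne hi]
  have h2 := congrArg φ h
  rw [map_mul, map_mul, map_mul, mul_comm (φ D), mul_left_inj] at h2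
  exact left_eq_mul.mp h2

/-- The vector is minus the off-diagonal part of column j of X; its entry at j is zero, so the
matrix is invertible. -/
lemma exists_clear_column (X : GLZero A δ) (j : σ) :
    ∃ v hv hj, ∀ i k, (colUnit (δ := δ) j v hv hj * X).val.1 i k =
      X.val.1 i k + (if i = j then 0 else -X.val.1 i j) * X.val.1 j k := by
  have hv : ∀ i, (if i = j then 0 else -X.val.1 i j) ∈ A.grading (δ i + δ j) := by
    intro i
    split_ifs
    · exact Submodule.zero_mem _
    · exact Submodule.neg_mem _ (X.val.2 i j)
  exact ⟨_, hv, if_pos rfl, colMatrix_mul_apply j _ hv X.val⟩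

/-- Left multiplication by an elementary column matrix clears a column with diagonal entry `1`. -/
lemma clear_column {X Y : GLZero A δ} {j : σ} (hX : X.val.1 j j = 1)
    (h : ∀ i k, Y.val.1 i k =
      X.val.1 i k + (if i = j then 0 else -X.val.1 i j) * X.val.1 j k) {s : Finset σ}
    (hs : ∀ k ∉ insert j s, ∀ i, X.val.1 i k = (1 : Matrix σ σ A) i k) :
    ∀ k ∉ s, ∀ i, Y.val.1 i k = (1 : Matrix σ σ A) i k := by
  intro k hk i
  rw [h]
  by_cases hkj : k = j
  · subst hkj
    rw [hX]
    by_cases hi : i = k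
    · subst hi; simp [hX]
    · simp [hi]
  · have hk' : k ∉ insert j s := by simp [hkj, hk]
    rw [hs k hk' i, hs k hk' j, Matrix.one_apply_ne (Ne.symm hkj), mul_zero, add_zero]

/-- Unitriangular matrices are products of elementary column matrices. -/
lemma mem_of_unitriangular {L : Type*} [LinearOrder L] (f : σ → L) (H : Subgroup (GLZero A δ))
    (hcol : ∀ j v hv hj, colUnit j v hv hj ∈ H) (X : GLZero A δ) (hdiag : ∀ i, X.val.1 i i = 1)
    (hX : ∀ i j, i ≠ j → ¬ f i < f j → X.val.1 i j = 0) : X ∈ H := by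
  suffices ∀ (s : Finset σ) (X : GLZero A δ), (∀ i, X.val.1 i i = 1) →
      (∀ i j, i ≠ j → ¬ f i < f j → X.val.1 i j = 0) →
      (∀ k ∉ s, ∀ i, X.val.1 i k = (1 : Matrix σ σ A) i k) → X ∈ H from
    this Finset.univ X hdiag hX (fun k hk => absurd (Finset.mem_univ k) hk)
  clear X hdiag hX
  intro s
  induction s using Finset.induction_on with
  | empty =>
    intro X _ _ h
    have : X = 1 := Units.ext (Subtype.ext (Matrix.ext fun i k => h k (by simp) i))
    exact this ▸ H.one_mem
  | insert j s _ ih =>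
    intro X hdiag hX hs
    obtain ⟨v, hv, hj, h⟩ := exists_clear_column X j
    rw [← H.mul_mem_cancel_left (hcol j v hv hj)]
    -- Triangularity survives the column operation: a nonzero product would need f i < f j together
    -- with j = k or f j < f k, hence f i < f k.
    have hz : ∀ i k, i ≠ j → ¬ f i < f k → X.val.1 i j * X.val.1 j k = 0 := by
      intro i k hi hik
      by_cases hij : f i < f j
      · by_cases hjk : j = k
        · exact absurd (hjk ▸ hij) hik
        · rw [hX j k hjk (fun h' => hik (hij.trans h')), mul_zero]
      · rw [hX i j hi hij, zero_mul]
    refine ih _ (fun i => ?_) (fun i k hik hf => ?_) (clear_column (hdiag j) h hs)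
    · rw [h, hdiag]
      split_ifs with hi
      · simp
      · rw [neg_mul, hz i i hi (lt_irrefl _), neg_zero, add_zero]
    · rw [h, hX i k hik hf]
      split_ifs with hi
      · simp
      · rw [neg_mul, hz i k hi hf, neg_zero, add_zero]

lemma coe_mem_zero {i j : σ} {X Y : GLZero A δ} :
    X.val.1 i j * Y.val.1 j i ∈ A.grading 0 := by
  have h := SetLike.GradedMul.mul_mem (X.val.2 i j) (Y.val.2 j i)
  rwa [add_comm (δ j), deg_add_self] at h

/-- Over an algebra whose degree-zero part is local, the group `GL⁰` is generated by the
elementary column matrices and the diagonal matrices. -/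
lemma mem_of_isLocalRing [IsLocalRing (A.grading 0)] (H : Subgroup (GLZero A δ))
    (hcol : ∀ j v hv hj, colUnit j v hv hj ∈ H) (hdiag : ∀ w, diagUnits A δ w ∈ H)
    (X : GLZero A δ) : X ∈ H := by
  suffices ∀ (s : Finset σ) (X : GLZero A δ),
      (∀ k ∉ s, ∀ i, X.val.1 i k = (1 : Matrix σ σ A) i k) → X ∈ H from
    this Finset.univ X (fun k hk => absurd (Finset.mem_univ k) hk)
  clear X
  intro s
  induction s using Finset.induction_on with
  | empty =>
    intro X h
    have : X = 1 := Units.ext (Subtype.ext (Matrix.ext fun i k => h k (by simp) i))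
    exact this ▸ H.one_mem
  | insert j s _ ih =>
    intro X hs
    have hmem : ∀ Y : GLZero A δ, Y.val.1 j j ∈ A.grading 0 := fun Y => by
      have h := Y.val.2 j j
      rwa [deg_add_self] at h
    -- Pivoting by a column operation: E changes only column j, so that the entry at (j, j) becomes
    -- a unit of A⁰ and the columns already reduced stay intact.
    obtain ⟨E, hE, hEs, hEj⟩ : ∃ E ∈ H,
        (∀ k ∉ insert j s, ∀ i, (X * E).val.1 i k = (1 : Matrix σ σ A) i k) ∧
        IsUnit (⟨(X * E).val.1 j j, hmem _⟩ : A.grading 0) := by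
      by_cases hu : IsUnit (⟨X.val.1 j j, hmem X⟩ : A.grading 0)
      · exact ⟨1, H.one_mem, by simpa using hs, by simpa using hu⟩
      · have h1 : ∑ k, (⟨X.val.1 j k * (X⁻¹).val.1 k j, coe_mem_zero⟩ : A.grading 0) = 1 := by
          apply Subtype.ext
          have h2 := congrArg (fun M : degZeroMatrices A δ => M.1 j j) X.mul_inv
          simp only [Subring.coe_mul, Matrix.mul_apply, Subring.coe_one, Matrix.one_apply_eq] at h2
          rw [AddSubmonoidClass.coe_finsetSum]
          exact h2
        -- The degree-zero products XⱼₖX⁻¹ₖⱼ add up to 1, so in a local ring one of them is a unit.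
        -- The factors themselves need not lie in A⁰.
        obtain ⟨k, hk⟩ : ∃ k,
            IsUnit (⟨X.val.1 j k * (X⁻¹).val.1 k j, coe_mem_zero⟩ : A.grading 0) := by
          by_contra! hno
          have h2 : (1 : A.grading 0) ∈ IsLocalRing.maximalIdeal (A.grading 0) := by
            rw [← h1]
            exact Ideal.sum_mem _ fun k _ => (IsLocalRing.mem_maximalIdeal _).mpr (hno k)
          exact (IsLocalRing.mem_maximalIdeal _).mp h2 isUnit_one
        have hkj : k ≠ j := by
          rintro rfl
          refine hu (isUnit_of_mul_isUnit_left (y := ⟨(X⁻¹).val.1 k k, hmem _⟩) ?_)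
          exact hk
        have hv : ∀ i, (Pi.single k ((X⁻¹).val.1 k j) : σ → A) i ∈ A.grading (δ i + δ j) := by
          intro i
          by_cases hi : i = k
          · subst hi; rw [Pi.single_eq_same]; exact (X⁻¹).val.2 i j
          · rw [Pi.single_eq_of_ne hi]; exact Submodule.zero_mem _
        -- E adds column k times X⁻¹ₖⱼ to column j. The new pivot is a nonunit plus a unit, hence a
        -- unit in a local ring.
        set E := colUnit j _ hv (Pi.single_eq_of_ne hkj.symm _) with hE
        refine ⟨E, hcol _ _ _ _, fun m hm i => ?_, ?_⟩
        · have hmj : m ≠ j := fun h => hm (by simp [h])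
          refine (mul_colMatrix_apply j _ hv _ _ _).trans ?_
          rw [if_neg hmj, add_zero, hs m hm]
        · by_contra hno
          have e : (X * E).val.1 j j =
              X.val.1 j j + X.val.1 j k * (X⁻¹).val.1 k j := by
            refine (mul_colMatrix_apply j _ hv _ _ _).trans ?_
            rw [if_pos rfl, Finset.sum_eq_single k]
            · rw [Pi.single_eq_same]
            · intro m _ hm
              rw [Pi.single_eq_of_ne hm, mul_zero]
            · simp
          have h2 := Ideal.sub_mem _ ((IsLocalRing.mem_maximalIdeal _).mpr hno)
            ((IsLocalRing.mem_maximalIdeal _).mpr hu)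
          have e2 : (⟨(X * E).val.1 j j, hmem _⟩ - ⟨X.val.1 j j, hmem X⟩ : A.grading 0) =
              ⟨X.val.1 j k * (X⁻¹).val.1 k j, coe_mem_zero⟩ :=
            Subtype.ext (sub_eq_of_eq_add' e)
          rw [e2] at h2
          exact (IsLocalRing.mem_maximalIdeal _).mp h2 hk
    obtain ⟨u, hu⟩ := hEj
    -- Row j is rescaled to make the pivot 1. The finished columns are unaffected because their
    -- entry in row j is zero.
    set Y := diagUnits A δ (Pi.mulSingle j u⁻¹) * (X * E) with hY
    have hYapp : ∀ i k, Y.val.1 i k =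
        (((Pi.mulSingle j u⁻¹ : σ → (A.grading 0)ˣ) i).val : A) * (X * E).val.1 i k := by
      intro i k
      rw [hY, Units.val_mul, Subring.coe_mul, diagUnits_apply, Matrix.diagonal_mul]
    have hY1 : Y.val.1 j j = 1 := by
      have h := congrArg Subtype.val u.inv_mul
      rw [hYapp, Pi.mulSingle_eq_same]
      have h2 := congrArg Subtype.val hu
      simp only at h2
      rw [← h2]
      exact h
    have hYs : ∀ k ∉ insert j s, ∀ i, Y.val.1 i k = (1 : Matrix σ σ A) i k := by
      intro k hk i
      rw [hYapp, hEs k hk]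
      by_cases hi : i = j
      · subst hi
        have hik : i ≠ k := fun h => hk (by simp [h])
        rw [Matrix.one_apply_ne hik, mul_zero]
      · rw [Pi.mulSingle_eq_of_ne hi]
        exact one_mul _
    obtain ⟨v, hv, hj, h⟩ := exists_clear_column Y j
    have hfin := ih _ (clear_column hY1 h hYs)
    rw [H.mul_mem_cancel_left (hcol j v hv hj), hY, H.mul_mem_cancel_left (hdiag _),
      H.mul_mem_cancel_right hE] at hfin
    exact hfin

/-- Two homomorphisms from `GL⁰` to a commutative group that agree on diagonal matrices are equal
if the degree-zero part is local. -/
lemma hom_ext_of_isLocalRing [CharZero K] [IsLocalRing (A.grading 0)] {G : Type*} [CommGroup G]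
    {φ ψ : GLZero A δ →* G} (h : ∀ w, φ (diagUnits A δ w) = ψ (diagUnits A δ w))
    (X : GLZero A δ) : φ X = ψ X :=
  mem_of_isLocalRing (φ.eqLocus ψ)
    (fun j v hv hj => (map_colUnit φ j v hv hj).trans (map_colUnit ψ j v hv hj).symm) h X

end Generation

/-! ### Localization at elements of degree zero -/

section Localization

/-- Degree-zero elements are central even though A is not commutative, so A can be localized as an
algebra over A⁰. -/
instance (A : GradedCommAlg.{u} K n) : Algebra (A.grading 0) A :=
  RingHom.toAlgebra' ⟨⟨⟨Subtype.val, rfl⟩, fun _ _ => rfl⟩, rfl, fun _ _ => rfl⟩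
    fun a b => zero_comm a.2 b

lemma zero_smul_def {A : GradedCommAlg.{u} K n} (r : A.grading 0) (a : A) : r • a = (r : A) * a :=
  rfl

/-- A family of additive projections gives a decomposition. -/
@[reducible]
noncomputable def decompositionOfProj {ι M : Type*} [Fintype ι] [DecidableEq ι] [AddCommGroup M]
    [Module K M] (ℳ : ι → Submodule K M) (P : ι → M →+ M) (hP : ∀ i x, P i x ∈ ℳ i)
    (hsum : ∀ x, ∑ i, P i x = x) (hne : ∀ i j x, x ∈ ℳ i → i ≠ j → P j x = 0) :
    DirectSum.Decomposition ℳ :=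
  DirectSum.Decomposition.ofAddHom ℳ
    (∑ i, (DirectSum.of (fun i => ℳ i) i).comp ((P i).codRestrict (ℳ i) (hP i)))
    (by
      ext x
      simp only [AddMonoidHom.comp_apply, AddMonoidHom.finsetSum_apply, map_sum,
        DirectSum.coeAddMonoidHom_of, AddMonoidHom.id_apply]
      exact hsum x)
    (by
      ext i x : 2
      have hx : P i x = x := by
        conv_rhs => rw [← hsum x]
        exact (Finset.sum_eq_single i (fun j _ hj => hne i j x x.2 hj.symm) (by simp)).symm
      simp only [AddMonoidHom.comp_apply, AddMonoidHom.finsetSum_apply,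
        DirectSum.coeAddMonoidHom_of, AddMonoidHom.id_apply]
      rw [Finset.sum_eq_single i]
      · congr 1
        exact Subtype.ext hx
      · intro j _ hj
        have : (P j).codRestrict (ℳ j) (hP j) x = 0 := Subtype.ext (hne i j x x.2 hj.symm)
        rw [this, map_zero]
      · simp)

variable (A : GradedCommAlg.{u} K n) (S : Submonoid (A.grading 0))

/-- The localization of a graded-commutative algebra at elements of degree zero. -/
def Loc : Type u := LocalizedModule S A

noncomputable instance : Ring (Loc A S) := inferInstanceAs (Ring (LocalizedModule S A))

noncomputable instance : Algebra (A.grading 0) (Loc A S) :=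
  inferInstanceAs (Algebra (A.grading 0) (LocalizedModule S A))

noncomputable instance : Algebra K (Loc A S) :=
  Algebra.compHom (Loc A S) (algebraMap K (A.grading 0))

variable {A S}

/-- Fractions. -/
def Loc.mk (a : A) (s : S) : Loc A S := LocalizedModule.mk a s

lemma Loc.ind {p : Loc A S → Prop} (h : ∀ a s, p (Loc.mk a s)) (x : Loc A S) : p x :=
  LocalizedModule.induction_on h x

lemma Loc.mk_eq_mk {a b : A} {s t : S} : Loc.mk a s = Loc.mk b t ↔
    ∃ u : S, (u : A.grading 0).1 * ((t : A.grading 0).1 * a) =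
      (u : A.grading 0).1 * ((s : A.grading 0).1 * b) :=
  LocalizedModule.mk_eq

lemma Loc.mk_mul_mk (a b : A) (s t : S) : Loc.mk a s * Loc.mk b t = Loc.mk (a * b) (s * t) :=
  LocalizedModule.mk_mul_mk

lemma Loc.mk_add_mk (a b : A) (s t : S) : Loc.mk a s + Loc.mk b t =
    Loc.mk ((t : A.grading 0).1 * a + (s : A.grading 0).1 * b) (s * t) :=
  LocalizedModule.mk_add_mk

lemma Loc.mk_neg (a : A) (s : S) : Loc.mk (-a) s = -Loc.mk a s := LocalizedModule.mk_neg

lemma Loc.one_def : (1 : Loc A S) = Loc.mk 1 1 := OreLocalization.one_def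

lemma Loc.mk_zero (s : S) : Loc.mk (0 : A) s = 0 := LocalizedModule.zero_mk s

lemma Loc.mk_self (s : S) : Loc.mk ((s : A.grading 0) : A) s = 1 := by
  rw [Loc.one_def, Loc.mk_eq_mk]
  exact ⟨1, by simp⟩

lemma Loc.smul_mk (c : K) (a : A) (s : S) : c • Loc.mk a s = Loc.mk (c • a) s := by
  have h : c • Loc.mk a s = (algebraMap K (A.grading 0) c) • Loc.mk a s := rfl
  rw [h]
  refine (LocalizedModule.smul'_mk (algebraMap K (A.grading 0) c) a s).trans ?_
  rw [zero_smul_def]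
  exact congrArg (LocalizedModule.mk · s) (Algebra.smul_def c a).symm

variable (A S) in
/-- The grading of the localization. -/
def Loc.grading (γ : Deg n) : Submodule K (Loc A S) where
  carrier := {x | ∃ a ∈ A.grading γ, ∃ s, x = Loc.mk a s}
  zero_mem' := ⟨0, Submodule.zero_mem _, 1, (Loc.mk_zero 1).symm⟩
  add_mem' := by
    rintro _ _ ⟨a, ha, s, rfl⟩ ⟨b, hb, t, rfl⟩
    refine ⟨_, Submodule.add_mem _ ?_ ?_, _, Loc.mk_add_mk a b s t⟩
    · simpa using SetLike.GradedMul.mul_mem t.1.2 ha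
    · simpa using SetLike.GradedMul.mul_mem s.1.2 hb
  smul_mem' := by
    rintro c _ ⟨a, ha, s, rfl⟩
    exact ⟨c • a, Submodule.smul_mem _ c ha, s, Loc.smul_mk c a s⟩

lemma Loc.mk_mem {γ : Deg n} {a : A} (ha : a ∈ A.grading γ) (s : S) :
    Loc.mk a s ∈ Loc.grading A S γ := ⟨a, ha, s, rfl⟩

instance : SetLike.GradedMonoid (Loc.grading A S) where
  one_mem := by
    rw [Loc.one_def]
    exact Loc.mk_mem SetLike.GradedOne.one_mem 1
  mul_mem := by
    rintro γ γ' _ _ ⟨a, ha, s, rfl⟩ ⟨b, hb, t, rfl⟩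
    rw [Loc.mk_mul_mk]
    exact Loc.mk_mem (SetLike.GradedMul.mul_mem ha hb) _

/-- The projection to a homogeneous component, linear over the degree-zero part. -/
noncomputable def projLin (A : GradedCommAlg.{u} K n) (γ : Deg n) : A →ₗ[A.grading 0] A where
  toFun := GradedAlgebra.proj A.grading γ
  map_add' := map_add _
  map_smul' r a := by
    rw [zero_smul_def, GradedAlgebra.proj_apply, GradedAlgebra.proj_apply,
      DirectSum.coe_decompose_mul_of_left_mem_zero A.grading r.2]
    rfl

/-- The projection of the localization to a homogeneous component. -/
noncomputable def Loc.proj (γ : Deg n) : Loc A S →+ Loc A S :=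
  (LocalizedModule.map S (projLin A γ)).toAddMonoidHom

lemma Loc.proj_mk (γ : Deg n) (a : A) (s : S) :
    Loc.proj γ (Loc.mk a s) = Loc.mk (GradedAlgebra.proj A.grading γ a) s :=
  LocalizedModule.map_mk S (projLin A γ) a s

/-- Forming fractions with a fixed denominator. -/
def Loc.mkHom (s : S) : A →+ Loc A S where
  toFun a := Loc.mk a s
  map_zero' := Loc.mk_zero s
  map_add' a b := by
    rw [Loc.mk_add_mk, Loc.mk_eq_mk]
    exact ⟨1, by simp [mul_add, mul_assoc]⟩

noncomputable instance : GradedAlgebra (Loc.grading A S) where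
  __ := (inferInstance : SetLike.GradedMonoid (Loc.grading A S))
  __ := decompositionOfProj (Loc.grading A S) Loc.proj
    (fun γ x => by
      induction x using Loc.ind with
      | h a s =>
        rw [Loc.proj_mk, GradedAlgebra.proj_apply]
        exact Loc.mk_mem (SetLike.coe_mem _) s)
    (fun x => by
      classical
      induction x using Loc.ind with
      | h a s =>
        simp only [Loc.proj_mk]
        have h : ∑ γ, GradedAlgebra.proj A.grading γ a = a := by
          conv_rhs => rw [← DirectSum.sum_support_decompose A.grading a]
          refine (Finset.sum_subset (Finset.subset_univ _) fun γ _ hγ => ?_).symm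
          rw [DFinsupp.notMem_support_iff] at hγ
          rw [GradedAlgebra.proj_apply, hγ]
          rfl
        have h2 := congrArg (Loc.mkHom s) h
        rw [map_sum] at h2
        exact h2)
    (by
      rintro γ γ' _ ⟨a, ha, s, rfl⟩ h
      rw [Loc.proj_mk, GradedAlgebra.proj_apply, DirectSum.decompose_of_mem_ne _ ha h,
        Loc.mk_zero])

variable (A S) in
/-- The localization as a graded-commutative algebra. -/
noncomputable def locAlg : GradedCommAlg.{u} K n where
  carrier := Loc A S
  grading := Loc.grading A S
  comm := by
    rintro α β _ _ ⟨a, ha, s, rfl⟩ ⟨b, hb, t, rfl⟩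
    rw [Loc.mk_mul_mk, Loc.mk_mul_mk, A.comm α β a b ha hb, mul_comm t s]
    exact map_zsmul (Loc.mkHom (s * t)) _ _

variable (A S) in
/-- The localization map. -/
noncomputable def locMap : A →ₐ[K] locAlg A S :=
  AlgHom.ofLinearMap
    { toFun := fun a => (Loc.mk a 1 : Loc A S)
      map_add' := map_add (Loc.mkHom 1)
      map_smul' := fun c a => (Loc.smul_mk c a 1).symm }
    Loc.one_def.symm
    (fun a b => by
      refine Eq.trans ?_ (Loc.mk_mul_mk a b 1 1).symm
      rw [one_mul]
      rfl)

lemma locMap_mem (γ : Deg n) (a : A) (ha : a ∈ A.grading γ) :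
    locMap A S a ∈ (locAlg A S).grading γ := Loc.mk_mem ha 1

/-- A degree-zero fraction a/s with a outside the prime has inverse s/a. If a lies in the prime,
then s − a does not, so 1 − a/s is a unit. -/
lemma isLocalRing_locAlg (I : Ideal (A.grading 0)) [I.IsPrime] :
    IsLocalRing ((locAlg A I.primeCompl).grading 0) := by
  have hunit : ∀ (a : A.grading 0) (s : I.primeCompl) (h : _), a ∉ I →
      IsUnit (⟨Loc.mk (a : A) s, h⟩ : (locAlg A I.primeCompl).grading 0) := by
    intro a s h ha
    refine IsUnit.of_mul_eq_one ⟨Loc.mk ((s : A.grading 0) : A) ⟨a, ha⟩, Loc.mk_mem s.1.2 _⟩ ?_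
    apply Subtype.ext
    refine (Loc.mk_mul_mk _ _ _ _).trans (Eq.trans ?_ (Loc.mk_self (s * ⟨a, ha⟩)))
    exact congrArg (Loc.mk · _) (zero_comm a.2 _)
  have : Nontrivial ((locAlg A I.primeCompl).grading 0) := by
    refine ⟨1, 0, fun h => ?_⟩
    have h1 : (Loc.mk 1 1 : Loc A I.primeCompl) = Loc.mk 0 1 :=
      Loc.one_def.symm.trans ((congrArg Subtype.val h).trans (Loc.mk_zero 1).symm)
    obtain ⟨u, hu⟩ := Loc.mk_eq_mk.mp h1
    refine u.2 ?_
    have h2 : (u : A.grading 0) = 0 := by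
      apply Subtype.ext
      simpa using hu
    rw [h2]
    exact I.zero_mem
  refine IsLocalRing.of_isUnit_or_isUnit_one_sub_self ?_
  rintro ⟨_, a, ha, s, rfl⟩
  by_cases h : (⟨a, ha⟩ : A.grading 0) ∈ I
  · right
    have h2 : (s : A.grading 0) - ⟨a, ha⟩ ∉ I := fun h' => s.2 (by simpa using I.add_mem h' h)
    have h3 := map_sub (Loc.mkHom s) ((s : A.grading 0) : A) a
    have h4 : (1 - ⟨Loc.mk a s, Loc.mk_mem ha s⟩ : (locAlg A I.primeCompl).grading 0) =
        ⟨_, Loc.mk_mem ((s : A.grading 0) - ⟨a, ha⟩).2 s⟩ :=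
      Subtype.ext (Eq.trans (congrArg (· - Loc.mk a s) (Loc.mk_self s).symm) h3.symm)
    rw [h4]
    exact hunit _ s _ h2
  · exact Or.inl (hunit ⟨a, ha⟩ s _ h)

/-- Equality in degree zero can be checked after passing to algebras with local degree-zero
part. -/
lemma eq_of_local {x y : A.grading 0} (h : ∀ (B : GradedCommAlg.{u} K n) (f : A →ₐ[K] B),
    (∀ (γ : Deg n) (a : A), a ∈ A.grading γ → f a ∈ B.grading γ) →
    (∀ γ, A.grading γ = ⊥ → B.grading γ = ⊥) → IsLocalRing (B.grading 0) → f x = f y) :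
    x = y := by
  by_contra hxy
  -- The annihilator of x − y is proper when x ≠ y. Localize at a maximal ideal M containing it:
  -- equality there would give u outside M annihilating x − y, contradicting u ∈ I ≤ M.
  let I : Ideal (A.grading 0) := Submodule.span (A.grading 0) {x - y} |>.annihilator
  have hI : I ≠ ⊤ := by
    intro hI
    have h1 : (1 : A.grading 0) ∈ I := hI ▸ Submodule.mem_top
    rw [Submodule.mem_annihilator_span_singleton, one_smul] at h1
    exact hxy (sub_eq_zero.mp h1)
  obtain ⟨M, hM, hIM⟩ := Ideal.exists_le_maximal I hI
  have h1 := h (locAlg A M.primeCompl) (locMap A M.primeCompl) locMap_mem (fun γ hγ => by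
      rw [eq_bot_iff]
      rintro _ ⟨a, ha, s, rfl⟩
      rw [hγ, Submodule.mem_bot] at ha
      rw [ha]
      exact Loc.mk_zero s) (isLocalRing_locAlg M)
  obtain ⟨u, hu⟩ := Loc.mk_eq_mk.mp h1
  refine u.2 (hIM ?_)
  rw [Submodule.mem_annihilator_span_singleton]
  apply Subtype.ext
  have h2 : ((u : A.grading 0) : A) * (x : A) = ((u : A.grading 0) : A) * (y : A) := by
    simpa using hu
  change ((u : A.grading 0) : A) * ((x : A) - (y : A)) = 0
  rw [mul_sub, h2, sub_self]

end Localization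

/-! ### The determinant expression for block-diagonal matrices -/

section BlockFormula

variable {σ : Type} [Fintype σ] [DecidableEq σ] {δ : σ → Deg n}

/-- The expression of the graded Berezinian of a block-diagonal matrix. -/
noncomputable def blockBer {A : GradedCommAlg.{u} K n} (X : degZeroMatrices A δ) : A.grading 0 :=
  (∏ u : Deg n with IsEven u, (diagBlock X u).det) *
    ∏ u : Deg n with IsOdd u, Ring.inverse (diagBlock X u).det

variable {A B : GradedCommAlg.{u} K n}

lemma isBlockDiagonal_of_trivial (hA : ∀ γ ≠ 0, A.grading γ = ⊥) (X : degZeroMatrices A δ) :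
    IsBlockDiagonal X := by
  intro i j hij
  have h := X.2 i j
  have h0 : δ i + δ j ≠ 0 := by
    intro h0
    refine hij ?_
    have h1 := congrArg (· + δ j) h0
    simpa [add_assoc, deg_add_self] using h1
  rwa [hA _ h0, Submodule.mem_bot] at h

lemma diagBlock_one (u : Deg n) : diagBlock (1 : degZeroMatrices A δ) u = 1 := by
  ext i j
  by_cases h : i = j
  · subst h
    rw [Matrix.one_apply_eq]
    exact Matrix.one_apply_eq _
  · rw [Matrix.one_apply_ne h]
    exact Matrix.one_apply_ne (fun h' => h (Subtype.ext h'))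

/-- Row i of X vanishes outside its block, so only indices of degree u contribute; block-diagonality
of the left factor is enough. -/
lemma diagBlock_mul {X : degZeroMatrices A δ} (hX : IsBlockDiagonal X) (Y : degZeroMatrices A δ)
    (u : Deg n) : diagBlock (X * Y) u = diagBlock X u * diagBlock Y u := by
  ext i j
  rw [Matrix.mul_apply, AddSubmonoidClass.coe_finsetSum]
  change (X.1 * Y.1) i j = ∑ k : {k // δ k = u}, X.1 i k * Y.1 k j
  rw [Matrix.mul_apply, ← Finset.sum_subtype (Finset.univ.filter fun k => δ k = u) (by simp)
    (fun k => X.1 i k * Y.1 k j)]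
  refine (Finset.sum_subset (Finset.subset_univ _) fun k _ hk => ?_).symm
  rw [hX i k (fun h => hk (by simp [← h, i.2])), zero_mul]

variable (A δ) in
/-- The determinant of a diagonal block, for an algebra concentrated in degree zero. -/
noncomputable def blockDetHom (hA : ∀ γ ≠ 0, A.grading γ = ⊥) (u : Deg n) :
    GLZero A δ →* (A.grading 0)ˣ :=
  Units.map
    { toFun := fun X => (diagBlock X u).det
      map_one' := by rw [diagBlock_one, Matrix.det_one]
      map_mul' := fun X Y => by
        rw [diagBlock_mul (isBlockDiagonal_of_trivial hA X), Matrix.det_mul] }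

variable (A δ) in
/-- The graded Berezinian for an algebra concentrated in degree zero. -/
noncomputable def blockBerHom (hA : ∀ γ ≠ 0, A.grading γ = ⊥) : GLZero A δ →* (A.grading 0)ˣ :=
  ∏ u : Deg n, if IsEven u then blockDetHom δ A hA u else (blockDetHom δ A hA u)⁻¹

lemma coe_blockBerHom (hA : ∀ γ ≠ 0, A.grading γ = ⊥) (X : GLZero A δ) :
    (blockBerHom δ A hA X).val = blockBer X.val := by
  have h : blockBerHom δ A hA X = (∏ u : Deg n with IsEven u, blockDetHom δ A hA u X) *
      ∏ u : Deg n with IsOdd u, (blockDetHom δ A hA u X)⁻¹ := by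
    rw [blockBerHom, Finset.prod_ite, MonoidHom.mul_apply, MonoidHom.finsetProd_apply,
      MonoidHom.finsetProd_apply]
    simp only [isEven_iff_not_isOdd, MonoidHom.inv_apply]
  rw [h, Units.val_mul, Units.coe_prod, Units.coe_prod, blockBer]
  congr 1
  exact Finset.prod_congr rfl fun u _ => (Ring.inverse_unit (blockDetHom δ A hA u X)).symm

lemma blockBerHom_diagUnits (hA : ∀ γ ≠ 0, A.grading γ = ⊥) (w : σ → (A.grading 0)ˣ) :
    blockBerHom δ A hA (diagUnits A δ w) = ∏ i, if IsEven (δ i) then w i else (w i)⁻¹ := by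
  have h : ∀ u, blockDetHom δ A hA u (diagUnits A δ w) = ∏ i with δ i = u, w i := by
    intro u
    apply Units.ext
    have h1 : diagBlock (diagUnits A δ w).val u =
        Matrix.diagonal fun i : {i // δ i = u} => (w i).val := by
      ext i j
      change (Matrix.diagonal fun i => ((w i).val : A)) (i : σ) (j : σ) = _
      by_cases h : i = j
      · subst h
        rw [Matrix.diagonal_apply_eq, Matrix.diagonal_apply_eq]
      · rw [Matrix.diagonal_apply_ne _ h, Matrix.diagonal_apply_ne _ (fun h' => h (Subtype.ext h'))]
        rfl
    change (diagBlock (diagUnits A δ w).val u).det = _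
    rw [h1, Matrix.det_diagonal, Units.coe_prod]
    exact (Finset.prod_subtype _ (by simp) fun i => (w i).val).symm
  rw [blockBerHom, MonoidHom.finsetProd_apply, ← Finset.prod_fiberwise Finset.univ δ]
  refine Finset.prod_congr rfl fun u _ => ?_
  split_ifs with hu
  · rw [h]
    refine Finset.prod_congr rfl fun i hi => ?_
    rw [if_pos ((Finset.mem_filter.mp hi).2 ▸ hu)]
  · rw [MonoidHom.inv_apply, h, ← Finset.prod_inv_distrib]
    refine Finset.prod_congr rfl fun i hi => ?_
    rw [if_neg ((Finset.mem_filter.mp hi).2 ▸ hu)]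

lemma isUnit_det_diagBlock (hA : ∀ γ ≠ 0, A.grading γ = ⊥) (X : GLZero A δ) (u : Deg n) :
    IsUnit (diagBlock X.val u).det := (blockDetHom δ A hA u X).isUnit

/-- The ring homomorphism between degree-zero parts. -/
def zeroMap {f : A →ₐ[K] B}
    (hf : ∀ (γ : Deg n) (a : A), a ∈ A.grading γ → f a ∈ B.grading γ) :
    A.grading 0 →+* B.grading 0 where
  toFun a := ⟨f a, hf 0 a a.2⟩
  map_one' := Subtype.ext (map_one f)
  map_mul' _ _ := Subtype.ext (map_mul f _ _)
  map_zero' := Subtype.ext (map_zero f)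
  map_add' _ _ := Subtype.ext (map_add f _ _)

/-- `Ring.inverse` is compatible with ring homomorphisms on units but not in general, its value on
nonunits being zero. Concentration in degree zero makes the block determinants of an invertible
matrix units. -/
lemma blockBer_glMap (hA : ∀ γ ≠ 0, A.grading γ = ⊥) {f : A →ₐ[K] B}
    (hf : ∀ (γ : Deg n) (a : A), a ∈ A.grading γ → f a ∈ B.grading γ) (X : GLZero A δ) :
    blockBer (glMap δ hf X).val = zeroMap hf (blockBer X.val) := by
  have h : ∀ u, (diagBlock (glMap δ hf X).val u).det = zeroMap hf (diagBlock X.val u).det :=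
    fun u => (RingHom.map_det (zeroMap hf) (diagBlock X.val u)).symm
  rw [blockBer, blockBer, map_mul, map_prod, map_prod]
  simp only [h]
  congr 1
  refine Finset.prod_congr rfl fun u _ => ?_
  obtain ⟨x, hx⟩ := isUnit_det_diagBlock hA X u
  rw [← hx, Ring.inverse_unit]
  have h2 := Ring.inverse_unit (Units.map (zeroMap hf : A.grading 0 →* B.grading 0) x)
  rw [Units.coe_map, Units.coe_map_inv] at h2
  exact h2

variable (A) in
/-- The degree-zero part, as a graded-commutative algebra concentrated in degree zero. -/
noncomputable def zeroPart : GradedCommAlg.{u} K n where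
  carrier := A.grading 0
  grading γ := if γ = 0 then ⊤ else ⊥
  graded :=
    { one_mem := by simp
      mul_mem := fun γ γ' a b ha hb => by
        by_cases hγ : γ = 0
        · subst hγ
          by_cases hγ' : γ' = 0
          · simp [hγ']
          · simp only [if_neg hγ', Submodule.mem_bot] at hb
            simp [hb]
        · simp only [if_neg hγ, Submodule.mem_bot] at ha
          simp [ha]
      __ := decompositionOfProj (K := K) (fun γ : Deg n => if γ = 0 then ⊤ else ⊥)
        (fun γ => if γ = 0 then AddMonoidHom.id _ else 0)
        (fun γ a => by
          by_cases hγ : γ = 0 <;> simp [hγ])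
        (fun a => by
          rw [Finset.sum_eq_single 0]
          · simp
          · intro γ _ hγ
            simp [hγ]
          · simp)
        (fun γ γ' a ha h => by
          by_cases hγ : γ = 0
          · subst hγ
            simp [h.symm]
          · simp only [if_neg hγ, Submodule.mem_bot] at ha
            simp [ha]) }
  comm α β a b ha hb := by
    by_cases hα : α = 0
    · rw [hα, form_zero_left, sgn_zero, one_smul, mul_comm]
    · simp only [if_neg hα, Submodule.mem_bot] at ha
      simp [ha]

lemma zeroPart_grading {γ : Deg n} (hγ : γ ≠ 0) : (zeroPart A).grading γ = ⊥ := if_neg hγ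

lemma mem_zeroPart (a : zeroPart A) : a ∈ (zeroPart A).grading 0 := by
  have h : (zeroPart A).grading 0 = ⊤ := if_pos rfl
  rw [h]
  exact Submodule.mem_top

variable (A) in
/-- The inclusion of the degree-zero part. -/
noncomputable def zeroPartMap : zeroPart A →ₐ[K] A where
  toFun := Subtype.val
  map_one' := rfl
  map_mul' _ _ := rfl
  map_zero' := rfl
  map_add' _ _ := rfl
  commutes' _ := rfl

lemma zeroPartMap_mem (γ : Deg n) (a : zeroPart A) (ha : a ∈ (zeroPart A).grading γ) :
    zeroPartMap A a ∈ A.grading γ := by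
  by_cases hγ : γ = 0
  · subst hγ
    exact a.2
  · rw [zeroPart_grading hγ, Submodule.mem_bot] at ha
    rw [ha, map_zero]
    exact Submodule.zero_mem _

/-- The entries of the block-diagonal part of a matrix. -/
noncomputable def zeroEntry (X : degZeroMatrices A δ) (i j : σ) : zeroPart A :=
  if h : δ i = δ j then (⟨X.1 i j, by
    have h1 := X.2 i j
    rwa [h, deg_add_self] at h1⟩ : A.grading 0) else 0

lemma zeroEntry_of_ne (X : degZeroMatrices A δ) {i j : σ} (h : δ i ≠ δ j) :
    zeroEntry X i j = 0 := dif_neg h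

lemma coe_zeroEntry {X : degZeroMatrices A δ} (hX : IsBlockDiagonal X) (i j : σ) :
    zeroPartMap A (zeroEntry X i j) = X.1 i j := by
  by_cases h : δ i = δ j
  · exact congrArg (zeroPartMap A) (dif_pos h)
  · rw [zeroEntry_of_ne X h, map_zero, hX i j h]

/-- The block-diagonal part of a matrix as a matrix over the degree-zero part. -/
noncomputable def toZeroPart (X : degZeroMatrices A δ) : degZeroMatrices (zeroPart A) δ :=
  ⟨fun i j => zeroEntry X i j, fun i j => by
    by_cases h : δ i = δ j
    · rw [h, deg_add_self]
      exact mem_zeroPart _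
    · beta_reduce
      rw [zeroEntry_of_ne X h]
      exact Submodule.zero_mem _⟩

lemma coe_toZeroPart {X : degZeroMatrices A δ} (hX : IsBlockDiagonal X) (i j : σ) :
    zeroPartMap A ((toZeroPart X).1 i j) = X.1 i j := coe_zeroEntry hX i j

lemma zeroPartMap_injective : Function.Injective (zeroPartMap A) := Subtype.val_injective

lemma isBlockDiagonal_mul {X Y : degZeroMatrices A δ} (hX : IsBlockDiagonal X)
    (hY : IsBlockDiagonal Y) : IsBlockDiagonal (X * Y) := by
  intro i j hij
  rw [Subring.coe_mul, Matrix.mul_apply]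
  refine Finset.sum_eq_zero fun k _ => ?_
  by_cases h : δ i = δ k
  · rw [hY k j (h ▸ hij), mul_zero]
  · rw [hX i k h, zero_mul]

lemma isBlockDiagonal_one : IsBlockDiagonal (1 : degZeroMatrices A δ) :=
  fun _ _ h => Matrix.one_apply_ne fun h' => h (congrArg δ h')

/-- Truncating X⁻¹ to its diagonal blocks still gives a right inverse of X, which must be X⁻¹
itself. -/
lemma isBlockDiagonal_inv {X : GLZero A δ} (hX : IsBlockDiagonal X.val) :
    IsBlockDiagonal (X⁻¹).val := by
  let Y : degZeroMatrices A δ := ⟨fun i j => if δ i = δ j then (X⁻¹).val.1 i j else 0,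
    fun i j => by
      beta_reduce
      split_ifs
      · exact (X⁻¹).val.2 i j
      · exact Submodule.zero_mem _⟩
  have h : X.val * Y = 1 := by
    apply Subtype.ext
    ext i j
    have h1 : (X.val.1 * (X⁻¹).val.1) i j = (1 : Matrix σ σ A) i j := by
      rw [← Subring.coe_mul, X.mul_inv, Subring.coe_one]
    rw [Subring.coe_mul, Subring.coe_one, ← h1, Matrix.mul_apply]
    by_cases hij : δ i = δ j
    · rw [Matrix.mul_apply]
      refine Finset.sum_congr rfl fun k _ => ?_
      change _ * (if δ k = δ j then _ else 0) = _
      split_ifs with hk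
      · rfl
      · rw [hX i k (fun h => hk (h.symm.trans hij)), zero_mul, zero_mul]
    · rw [h1, Matrix.one_apply_ne fun h => hij (congrArg δ h)]
      refine Finset.sum_eq_zero fun k _ => ?_
      change _ * (if δ k = δ j then _ else 0) = _
      split_ifs with hk
      · rw [hX i k (fun h => hij (h.trans hk)), zero_mul]
      · rw [mul_zero]
  have hY : IsBlockDiagonal Y := fun i j hij => if_neg hij
  rwa [← Units.inv_eq_of_mul_eq_one_right h] at hY

lemma toZeroPart_mul {X Y : degZeroMatrices A δ} (hX : IsBlockDiagonal X)
    (hY : IsBlockDiagonal Y) : toZeroPart X * toZeroPart Y = toZeroPart (X * Y) := by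
  apply Subtype.ext
  ext i j
  apply zeroPartMap_injective
  rw [coe_toZeroPart (isBlockDiagonal_mul hX hY), Subring.coe_mul, Subring.coe_mul,
    Matrix.mul_apply, Matrix.mul_apply, map_sum]
  simp only [map_mul, coe_toZeroPart hX, coe_toZeroPart hY]

lemma toZeroPart_one : toZeroPart (1 : degZeroMatrices A δ) = 1 := by
  apply Subtype.ext
  ext i j
  apply zeroPartMap_injective
  rw [coe_toZeroPart isBlockDiagonal_one, Subring.coe_one, Subring.coe_one]
  by_cases h : i = j
  · rw [h, Matrix.one_apply_eq, Matrix.one_apply_eq, map_one]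
  · rw [Matrix.one_apply_ne h, Matrix.one_apply_ne h, map_zero]

/-- An invertible block-diagonal matrix comes from the degree-zero part. -/
lemma exists_glMap_zeroPart {X : GLZero A δ} (hX : IsBlockDiagonal X.val) :
    ∃ X' : GLZero (zeroPart A) δ, glMap δ zeroPartMap_mem X' = X := by
  refine ⟨⟨toZeroPart X.val, toZeroPart (X⁻¹).val, ?_, ?_⟩, ?_⟩
  · rw [toZeroPart_mul hX (isBlockDiagonal_inv hX), X.mul_inv, toZeroPart_one]
  · rw [toZeroPart_mul (isBlockDiagonal_inv hX) hX, X.inv_mul, toZeroPart_one]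
  · exact (eq_glMap zeroPartMap_mem fun i j => (coe_toZeroPart hX i j).symm).symm

end BlockFormula

/-! ### Identification with the graded Berezinian -/

section Main

variable {N : ℕ} {deg : Fin N → Deg n} {π : Deg n}

/-- After localization both sides are homomorphisms on GL⁰ over a local ring with the same diagonal
values. The localization remains concentrated in degree zero, so the determinant expression stays
multiplicative there. -/
lemma cohBer_eq_blockBer_of_trivial [CharZero K] (hπ : IsOdd π) {A : GradedCommAlg.{u} K n}
    (hA : ∀ γ ≠ 0, A.grading γ = ⊥) (X : GLZero A deg) :
    (cohBer A deg hπ X).val = blockBer X.val := by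
  refine eq_of_local fun B f hf hbot _ => ?_
  have hB : ∀ γ ≠ 0, B.grading γ = ⊥ := fun γ hγ => hbot γ (hA γ hγ)
  have h : cohBer B deg hπ (glMap deg hf X) = blockBerHom deg B hB (glMap deg hf X) :=
    hom_ext_of_isLocalRing (fun w => by rw [cohBer_diagUnits, blockBerHom_diagUnits]) _
  rw [← cohBer_natural hπ hf, h, coe_blockBerHom, blockBer_glMap hA]
  rfl

/-- The matrix lifts to the algebra A⁰ concentrated in degree zero, and both sides are compatible
with its inclusion into A. -/
lemma cohBer_block_diagonal [CharZero K] (hπ : IsOdd π) {A : GradedCommAlg.{u} K n}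
    (X : GLZero A deg) (hX : IsBlockDiagonal X.val) :
    (cohBer A deg hπ X).val = blockBer X.val := by
  obtain ⟨X', rfl⟩ := exists_glMap_zeroPart hX
  rw [blockBer_glMap (fun _ => zeroPart_grading), ← cohBer_eq_blockBer_of_trivial hπ
    (fun _ => zeroPart_grading)]
  exact Subtype.ext (cohBer_natural hπ zeroPartMap_mem X')

lemma stdKey_injective : Function.Injective (stdKey (n := n)) := by
  intro γ γ' h
  have h1 := congrArg (fun x => ofLex (ofLex x).2) h
  funext i
  exact ZMod.val_injective 2 (congrFun h1 i)

section Unitriangular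

variable {σ : Type} {A : GradedCommAlg.{u} K n} {δ : σ → Deg n}

lemma diag_eq_one [Fintype σ] [DecidableEq σ] {X : degZeroMatrices A δ}
    (h : ∀ u, diagBlock X u = 1) (i : σ) :
    X.1 i i = 1 := by
  have h1 := congrArg (fun M => ((M ⟨i, rfl⟩ ⟨i, rfl⟩ : A.grading 0) : A)) (h (δ i))
  simp only [Matrix.one_apply_eq] at h1
  exact h1

lemma eq_zero_of_diagBlock [Fintype σ] [DecidableEq σ] {X : degZeroMatrices A δ}
    (h : ∀ u, diagBlock X u = 1) {i j : σ}
    (hij : i ≠ j) (hd : δ i = δ j) : X.1 i j = 0 := by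
  have h1 := congrArg (fun M => ((M ⟨i, hd⟩ ⟨j, rfl⟩ : A.grading 0) : A)) (h (δ j))
  have hne : (⟨i, hd⟩ : {k // δ k = δ j}) ≠ ⟨j, rfl⟩ := fun h => hij (congrArg Subtype.val h)
  simp only [Matrix.one_apply_ne hne] at h1
  exact h1

/-- The kernel contains all elementary column matrices, and these generate the unitriangular
matrices. Hence the value 1 is forced for every homomorphism to a commutative group. -/
lemma map_upper_unitriangular [CharZero K] [Fintype σ] [DecidableEq σ] {G : Type*} [CommGroup G]
    (φ : GLZero A δ →* G) {X : GLZero A δ} (hX : IsUpperUnitriangular X.val) : φ X = 1 :=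
  mem_of_unitriangular (fun i => stdKey (δ i)) φ.ker (map_colUnit φ) X (diag_eq_one hX.1)
    fun i j hij h => by
      rcases (not_lt.mp h).lt_or_eq with h | h
      · exact hX.2 i j h
      · exact eq_zero_of_diagBlock hX.1 hij (stdKey_injective h.symm)

lemma map_lower_unitriangular [CharZero K] [Fintype σ] [DecidableEq σ] {G : Type*} [CommGroup G]
    (φ : GLZero A δ →* G) {X : GLZero A δ} (hX : IsLowerUnitriangular X.val) : φ X = 1 :=
  mem_of_unitriangular (fun i => OrderDual.toDual (stdKey (δ i))) φ.ker (map_colUnit φ) X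
    (diag_eq_one hX.1) fun i j hij h => by
      rcases (not_lt.mp h).lt_or_eq with h | h
      · exact hX.2 i j h
      · exact eq_zero_of_diagBlock hX.1 hij (stdKey_injective (OrderDual.toDual.injective h).symm)

end Unitriangular

lemma isGradedBerezinian_cohBer [CharZero K] (hπ : IsOdd π) :
    IsGradedBerezinian deg fun A : GradedCommAlg.{u} K n => cohBer A deg hπ where
  natural A B f hf T T' h := by
    rw [eq_glMap hf h]
    exact cohBer_natural hπ hf T
  block_diagonal A X hX := cohBer_block_diagonal hπ X hX
  upper_unitriangular A X hX := map_upper_unitriangular _ hX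
  lower_unitriangular A X hX := map_lower_unitriangular _ hX

lemma diagUnits_isBlockDiagonal {σ : Type} [Fintype σ] [DecidableEq σ] {A : GradedCommAlg.{u} K n}
    {δ : σ → Deg n} (w : σ → (A.grading 0)ˣ) : IsBlockDiagonal (diagUnits A δ w).val := by
  intro i j h
  rw [diagUnits_apply]
  exact Matrix.diagonal_apply_ne _ fun hij => h (congrArg δ hij)

/-- The graded Berezinian is unique. -/
lemma IsGradedBerezinian.unique [CharZero K] {σ : Type} [Fintype σ] [DecidableEq σ]
    {δ : σ → Deg n} {G G' : (A : GradedCommAlg.{u} K n) → GLZero A δ →* (A.grading 0)ˣ}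
    (hG : IsGradedBerezinian δ G) (hG' : IsGradedBerezinian δ G') : G = G' := by
  funext A
  refine MonoidHom.ext fun T => Units.ext (eq_of_local fun B f hf _ _ => ?_)
  rw [← hG.natural A B f hf T (glMap δ hf T) fun _ _ => rfl,
    ← hG'.natural A B f hf T (glMap δ hf T) fun _ _ => rfl]
  -- Diagonal matrices are block diagonal, so both families have the same prescribed values on them,
  -- and B⁰ is local.
  have h : G B (glMap δ hf T) = G' B (glMap δ hf T) :=
    hom_ext_of_isLocalRing (fun w => Units.ext (by
      rw [hG.block_diagonal B _ (diagUnits_isBlockDiagonal w),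
        hG'.block_diagonal B _ (diagUnits_isBlockDiagonal w)])) _
  rw [h]

/-- On the top class, reducing φ_T(ξ₁⋯ξ_N) modulo D leaves the coefficient read off by `topCoeff`,
which is `cohBer`. Right A-linearity extends this to all classes. -/
lemma Phi_toTotal [CharZero K] (hπ : IsOdd π) {A : GradedCommAlg.{u} K n} (T : GLZero A deg)
    (c : Cohomology A deg π N) : Phi π T (toTotal A deg π N c) =
      toTotal A deg π N (MulOpposite.op ((cohBer A deg hπ T).val : A) • c) := by
  obtain ⟨a, rfl⟩ := (topClass_bijective (A := A) (deg := deg) hπ).2 c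
  set b : A := ((cohBer A deg hπ T).val : A) with hb
  have h1 : Phi π T (toTotal A deg π N (Submodule.Quotient.mk
      ⟨topElem A deg π, topElem_mem_cocycles hπ⟩)) =
      toTotal A deg π N (MulOpposite.op b • Submodule.Quotient.mk
        ⟨topElem A deg π, topElem_mem_cocycles hπ⟩) := by
    have hd : dElem A deg π * action π T (topElem A deg π) = 0 := by
      have h := congrArg (action π T) (dElem_mul_topElem (A := A) (deg := deg) hπ)
      rw [map_mul, action_dElem, map_zero] at h
      exact h
    obtain ⟨a, p, hp⟩ := exists_of_dElem_mul_eq_zero hπ hd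
    have ha : a = b := by
      rw [hb, cohBer_apply, hp, map_add, topCoeff_dElem_mul, add_zero, topCoeff_topElem_mul_const]
    refine (Submodule.Quotient.eq _).mpr ⟨p, ?_⟩
    change dElem A deg π * p = action π T (topElem A deg π) - topElem A deg π * const A _ b
    rw [hp, ha, add_sub_cancel_left]
  simp only [map_smul, h1, smul_smul]
  -- The scalar b has degree zero and is central, so multiplying by b before or after a gives the
  -- same class.
  rw [← MulOpposite.op_mul, ← MulOpposite.op_mul, zero_comm (cohBer A deg hπ T).val.2]

end Main

end GradedKoszul

theorem mainTheorem2 {K : Type v} [Field K] [CharZero K] {n N : ℕ}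
    (deg : Fin N → Deg n) (hdeg : Monotone fun i => stdKey (deg i))
    (π : Deg n) (hπ : IsOdd π) :
    (∃! G : (A : GradedCommAlg.{u, v} K n) → GLZero A deg →* (A.grading 0)ˣ,
      IsGradedBerezinian deg G) ∧
    (∀ A : GradedCommAlg.{u, v} K n,
      Function.Bijective (toTotal A deg π N) ∧
      ∃ h : topElem A deg π ∈ cocycles A deg π N,
        Function.Bijective fun a : A =>
          MulOpposite.op a •
            (Submodule.Quotient.mk ⟨topElem A deg π, h⟩ : Cohomology A deg π N)) ∧
    ∀ G : (A : GradedCommAlg.{u, v} K n) → GLZero A deg →* (A.grading 0)ˣ,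
      IsGradedBerezinian deg G →
      ∀ (A : GradedCommAlg.{u, v} K n) (T : GLZero A deg) (c : Cohomology A deg π N),
        Phi π T (toTotal A deg π N c) =
          toTotal A deg π N
            (MulOpposite.op (((G A T).val : A.grading 0) : A) • c) := by
  refine ⟨⟨_, isGradedBerezinian_cohBer hπ, fun G hG => hG.unique (isGradedBerezinian_cohBer hπ)⟩,
    fun A => ⟨toTotal_bijective hπ, topElem_mem_cocycles hπ, topClass_bijective hπ⟩,
    fun G hG A T c => ?_⟩
  rw [hG.unique (isGradedBerezinian_cohBer hπ)]
  exact Phi_toTotal hπ T c
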